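/- Let $\Omega\subset\mathbb{R}^2$ be a bounded domain, let $1/2\le s<1$ and $2-s<\alpha\le 2$. For a positive Borel measure $\mu$ on $\mathbb{R}^2$ put $$c_\alpha(\mu)=\sup_{x\in\mathbb{R}^2,\ r>0}\frac{\mu(B(x,r))}{r^\alpha},$$ let $I_s(x)=|x|^{s-2}$ be the Riesz kernel, let $G(x)=e^{-|x|^2}$ and $G_N(x)=N^2G(Nx)$, and define the nonelliptic Schrödinger flow by $$e^{it\Box}[F](x)=\frac1{(2\pi)^2}\int_{\mathbb{R}^2}e^{ix\cdot\xi}\,e^{-it(\xi_1^2-\xi_2^2)}\,\widehat F(\xi)\,d\xi,\qquad \widehat F(\xi)=\int_{\mathbb{R}^2} e^{-ix\cdot\xi}F(x)\,dx,$$ where $\widehat F$ is understood in the sense of tempered distributions when $F$ is not integrable. Then for every (complex-valued) $g\in L^2(\mathbb{R}^2)$ the convolution $I_s*g$ converges absolutely almost everywhere, and for every integer $N\ge1$ the convolution $G_N*I_s*g=G_N*(I_s*g)$ converges absolutely everywhere and its distributional Fourier transform is an integrable function, so that $e^{it\Box}[G_N*I_s*g]$ is well defined pointwise. Moreover there is a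 finite constant $C$, depending only on $s$, $\alpha$ and $\Omega$, such that $$\int \sup_{k\ge1}\,\sup_{N\ge1}\Big|e^{i\frac1k\Box}[G_N*I_s*g](x)\Big|\,d\mu(x)\ \le\ C\,\sqrt{c_\alpha(\mu)}\ \|g\|_{L^2(\mathbb{R}^2)}$$ (the suprema being over integers $k$ and $N$) for every $g\in L^2(\mathbb{R}^2)$ and every Borel probability measure $\mu$ with $c_\alpha(\mu)<\infty$ that is carried by $\Omega$, i.e. $\mu(\mathbb{R}^2\setminus\Omega)=0$. -/

import Mathlib

open MeasureTheory Set
open scoped ENNReal NNReal Convolution SchwartzMap ContDiff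

noncomputable section

/-- The Euclidean plane. -/
abbrev Plane : Type := EuclideanSpace ℝ (Fin 2)

/-- The Riesz kernel `I_s(x) = |x| ^ (s - 2)` on the plane. -/
def rieszKernel (s : ℝ) (x : Plane) : ℝ := ‖x‖ ^ (s - 2)

/-- The rescaled Gaussian `G_N(x) = N ^ 2 G(N x)`, where `G(x) = exp (-|x| ^ 2)`. -/
def gaussianScale (N : ℕ) (x : Plane) : ℝ := (N : ℝ) ^ 2 * Real.exp (-‖(N : ℝ) • x‖ ^ 2)

/-- The classical Fourier transform on the plane, `φ ↦ ∫ exp (-i x·ξ) φ(x) dx`. -/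
def planeFourier (φ : Plane → ℂ) (ξ : Plane) : ℂ :=
  ∫ x : Plane, Complex.exp (-(Complex.I * (inner ℝ x ξ : ℝ))) * φ x

/-- The function `h` is the Fourier transform of the function `F` in the sense of tempered
distributions: both functions can be integrated against every Schwartz function, and
`∫ F φ̂ = ∫ h φ` for every Schwartz function `φ`. -/
def IsFourierTransform (F h : Plane → ℂ) : Prop :=
  ∀ φ : 𝓢(Plane, ℂ),
    Integrable (fun x => F x * planeFourier φ x) ∧ Integrable (fun ξ => h ξ * φ ξ) ∧
      ∫ x, F x * planeFourier φ x = ∫ ξ, h ξ * φ ξ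

/-- The distributional Fourier transform of a function is unique up to null sets. -/
theorem IsFourierTransform.ae_eq {F h₁ h₂ : Plane → ℂ} (H₁ : IsFourierTransform F h₁)
    (H₂ : IsFourierTransform F h₂) : h₁ =ᵐ[volume] h₂ := by
  have loc : ∀ h : Plane → ℂ, IsFourierTransform F h → LocallyIntegrable h := by
    intro h H x
    let b : ContDiffBump x := ⟨1, 2, one_pos, one_lt_two⟩
    have hc : HasCompactSupport fun y => ((b y : ℝ) : ℂ) :=
      b.hasCompactSupport.comp_left (g := ((↑) : ℝ → ℂ)) Complex.ofReal_zero
    have hd : ContDiff ℝ ∞ fun y => ((b y : ℝ) : ℂ) :=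
      Complex.ofRealCLM.contDiff.comp b.contDiff
    refine ⟨Metric.closedBall x 1, Metric.closedBall_mem_nhds x one_pos, ?_⟩
    refine ((H (hc.toSchwartzMap hd)).2.1.integrableOn (s := Metric.closedBall x 1)).congr_fun
      (fun y hy => ?_) Metric.isClosed_closedBall.measurableSet
    have hy1 : b y = 1 := b.one_of_mem_closedBall hy
    simp [hy1]
  refine ae_eq_of_integral_contDiff_smul_eq (loc _ H₁) (loc _ H₂) fun g hg hgc => ?_
  have hc : HasCompactSupport fun y => ((g y : ℝ) : ℂ) :=
    hgc.comp_left (g := ((↑) : ℝ → ℂ)) Complex.ofReal_zero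
  have hd : ContDiff ℝ ∞ fun y => ((g y : ℝ) : ℂ) := Complex.ofRealCLM.contDiff.comp hg
  have e := (H₁ (hc.toSchwartzMap hd)).2.2.symm.trans (H₂ (hc.toSchwartzMap hd)).2.2
  simpa [mul_comm] using e

open Classical in
/-- The Fourier transform of a function whose distributional Fourier transform is a function
(and `0` for all other functions). -/
def fourierFunction (F : Plane → ℂ) : Plane → ℂ :=
  if H : ∃ h, IsFourierTransform F h then H.choose else 0

/-- The nonelliptic Schrödinger flow
`exp (i t □) F (x) = (2π)⁻² ∫ exp (i x·ξ) exp (-i t (ξ₁² - ξ₂²)) F̂(ξ) dξ`. -/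
def schrodingerFlow (t : ℝ) (F : Plane → ℂ) (x : Plane) : ℂ :=
  (1 / (2 * (Real.pi : ℂ)) ^ 2) *
    ∫ ξ : Plane, Complex.exp (Complex.I * (inner ℝ x ξ : ℝ)) *
      Complex.exp (-(Complex.I * ((t * (ξ 0 ^ 2 - ξ 1 ^ 2) : ℝ) : ℂ))) * fourierFunction F ξ

/-- `c_α(μ) = sup_{x, r > 0} μ(B(x, r)) / r ^ α`. -/
def fractalConst (α : ℝ) (μ : Measure Plane) : ℝ≥0∞ :=
  ⨆ (x : Plane) (r : ℝ) (_ : 0 < r), μ (Metric.ball x r) / ENNReal.ofReal (r ^ α)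

/-- The `α`-dimensional probability measures carried by `Ω`. -/
structure IsFractalProbability (α : ℝ) (Ω : Set Plane) (μ : Measure Plane) : Prop where
  isProbability : IsProbabilityMeasure μ
  nonneg : 0 ≤ α
  le_two : α ≤ 2
  fractalConst_lt_top : fractalConst α μ < ⊤
  carried : μ Ωᶜ = 0

end

/-! On the frequency side, `G_N * I_s * g` is an explicit multiplier, a constant times `|η|^(-s)`
times a Gaussian, applied to `ĝ`. For `s < 1` the multiplier lies in `L¹ ∩ L²`, so its product with
`ĝ` is integrable. This gives the pointwise meaning of the flow, together with Tonelli for the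
convolutions themselves.

For the maximal bound, restrict to finitely many pairs `(k, N)`, choose a maximizing pair measurably
in `x`, and linearize. Duality and Cauchy-Schwarz reduce the estimate to the `L²` norm of `∫ E x η
dμ(x)`, where `E` contains the phase, the multiplier and a factor of modulus at most one. Expanding
the square (`lintegral_enorm_sq_integral_le`) leaves the kernel `∫ |η|^(-2s) exp(-ε|η|²) exp(i z·η -
i t(η₁² - η₂²)) dη`. The decisive fact, `exists_norm_integral_riesz_saddle_le`, bounds it by `C
|z|^(2s-2)` uniformly in `t` and `ε`. Writing `|η|^(-2s)` as a superposition of Gaussians reduces it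
to Gaussian integrals known exactly. Only their moduli enter, so the signature of the quadratic form
plays no role. The condition `s ≥ 1/2` gives uniformity as the rescaled time tends to zero.

What remains is the potential `∫ |x-y|^(2s-2) dμ(x)`, bounded by a multiple of `c_α(μ)` since `2 -
2s < 2 - s < α` (`exists_lintegral_enorm_rpow_le`). The square root in the theorem comes from the
duality step. No bound depends on the finite set of pairs, so monotone convergence concludes. -/

open scoped FourierTransform

/-! ### Gamma integrals and the saddle Gaussian -/

/-- The Gaussian `exp (-b |η|²)` times a negative power `|η|^(-p)`, `p < 2`, is integrable on the
plane. -/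
theorem integrable_norm_rpow_mul_exp_neg {p b : ℝ} (hp : p < 2) (hb : 0 < b) :
    Integrable fun η : Plane => ‖η‖ ^ (-p) * Real.exp (-b * ‖η‖ ^ 2) := by
  rw [integrable_fun_norm_addHaar (volume : Measure Plane)
    (f := fun r : ℝ => r ^ (-p) * Real.exp (-b * r ^ 2))]
  have h := integrableOn_rpow_mul_exp_neg_mul_sq hb (s := 1 - p) (by linarith)
  refine h.congr_fun (fun r hr => ?_) measurableSet_Ioi
  have hr' : (0 : ℝ) < r := hr
  simp only [finrank_euclideanSpace, Fintype.card_fin, smul_eq_mul]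
  rw [sub_eq_add_neg, Real.rpow_add hr', Real.rpow_one]
  norm_num
  ring

/-- A negative power as a superposition of exponentials. -/
theorem integral_rpow_mul_exp_neg_mul {q c : ℝ} (hq : 0 < q) (hc : 0 < c) :
    ∫ u in Ioi (0 : ℝ), u ^ (q - 1) * Real.exp (-c * u) = c ^ (-q) * Real.Gamma q := by
  have h := integral_rpow_mul_exp_neg_mul_rpow (p := 1) (q := q - 1) (b := c) one_pos
    (by linarith) hc
  simpa using h

theorem integrableOn_rpow_mul_exp_neg_mul {q c : ℝ} (hq : 0 < q) (hc : 0 < c) :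
    IntegrableOn (fun u : ℝ => u ^ (q - 1) * Real.exp (-c * u)) (Ioi 0) := by
  have h := integrableOn_rpow_mul_exp_neg_mul_rpow (p := 1) (s := q - 1) (b := c)
    (by linarith) one_pos hc
  simpa using h

/-- The oscillating Gaussian integral with saddle-shaped phase. -/
theorem norm_integral_gaussian_saddle {a : ℝ} (ha : 0 < a) (t : ℝ) (z : Plane) :
    ‖∫ η : Plane, Complex.exp (-(a * ‖η‖ ^ 2 : ℝ) + Complex.I * (inner ℝ z η : ℝ)
      - Complex.I * ((t * (η 0 ^ 2 - η 1 ^ 2) : ℝ) : ℂ))‖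
      = Real.pi / ‖(a + t * Complex.I : ℂ)‖ *
          Real.exp (-(a * ‖z‖ ^ 2 / (4 * ‖(a + t * Complex.I : ℂ)‖ ^ 2))) := by
  -- The indefinite phase gives the two coordinates conjugate coefficients `a ± it`. Their moduli
  -- agree, and so do the real parts of their inverses, so the modulus of the integral is the one
  -- for the phase `t|η|²`.
  let b : Fin 2 → ℂ := ![a + t * Complex.I, a - t * Complex.I]
  let c : Fin 2 → ℂ := fun i => Complex.I * (z i : ℂ)
  have hb : ∀ i, 0 < (b i).re := by
    intro i; fin_cases i <;> simp [b, ha]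
  have key := GaussianFourier.integral_cexp_neg_sum_mul_add hb c
  have e : ∫ η : Plane, Complex.exp (-(a * ‖η‖ ^ 2 : ℝ) + Complex.I * (inner ℝ z η : ℝ)
      - Complex.I * ((t * (η 0 ^ 2 - η 1 ^ 2) : ℝ) : ℂ))
      = ∫ v : Fin 2 → ℝ, Complex.exp (-∑ i, b i * (v i : ℂ) ^ 2 + ∑ i, c i * v i) := by
    rw [← (PiLp.volume_preserving_toLp (Fin 2)).integral_comp
      (MeasurableEquiv.toLp 2 _).measurableEmbedding]
    congr 1
    ext v
    congr 1
    simp [b, c, EuclideanSpace.norm_sq_eq, PiLp.inner_apply, Fin.sum_univ_two]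
    ring
  have hB : ‖(a - t * Complex.I : ℂ)‖ = ‖(a + t * Complex.I : ℂ)‖ := by
    rw [← Complex.norm_conj (a + t * Complex.I : ℂ)]
    simp [sub_eq_add_neg]
  have hn : Complex.normSq (a + t * Complex.I : ℂ) = ‖(a + t * Complex.I : ℂ)‖ ^ 2 :=
    Complex.normSq_eq_norm_sq _
  have hn' : Complex.normSq (a - t * Complex.I : ℂ) = ‖(a + t * Complex.I : ℂ)‖ ^ 2 := by
    rw [Complex.normSq_eq_norm_sq, hB]
  have hB0 : 0 < ‖(a + t * Complex.I : ℂ)‖ := by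
    rw [norm_pos_iff]; intro h; have := congrArg Complex.re h; simp at this; linarith
  rw [e, key, Fin.prod_univ_two]
  set B := ‖(a + t * Complex.I : ℂ)‖ with hBdef
  have hsq : ∀ w : ℂ, ‖w ^ (1 / 2 : ℂ)‖ = ‖w‖ ^ (1 / 2 : ℝ) := by
    intro w
    have := Complex.norm_cpow_real w (1 / 2)
    simpa using this
  have hb0 : ‖b 0‖ = B := by simp [b, hBdef]
  have hb1 : ‖b 1‖ = B := by simp [b, hBdef, hB]
  have hexp : ∀ i, (c i ^ 2 / (4 * b i)).re = -(a * (z i) ^ 2 / (4 * B ^ 2)) := by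
    intro i
    have hc : c i ^ 2 = ((-(z i) ^ 2 : ℝ) : ℂ) := by
      simp [c, mul_pow]
    have h4 : c i ^ 2 / (4 * b i) = ((-(z i) ^ 2 / 4 : ℝ) : ℂ) * (b i)⁻¹ := by
      rw [hc]; push_cast; rw [div_mul_eq_div_div, div_eq_mul_inv]
    rw [h4, Complex.re_ofReal_mul, Complex.inv_re]
    fin_cases i
    · simp only [b, Fin.zero_eta, Matrix.cons_val_zero, hn]; simp; ring
    · simp only [b, Fin.mk_one, Matrix.cons_val_one]; simp [hn']; ring
  simp only [norm_mul, hsq, norm_div, hb0, hb1, Complex.norm_exp, hexp, Complex.norm_real,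
    Real.norm_eq_abs, abs_of_pos Real.pi_pos]
  rw [mul_mul_mul_comm, ← Real.rpow_add (by positivity), ← Real.exp_add]
  rw [add_halves, Real.rpow_one, EuclideanSpace.norm_sq_eq, Fin.sum_univ_two]
  simp only [Real.norm_eq_abs, sq_abs]
  congr 2
  ring

/-! ### The oscillatory Riesz kernel, uniformly in time -/

theorem integrableOn_rpow_div_one_add {s : ℝ} (hs : 0 < s) (hs1 : s < 1) :
    IntegrableOn (fun v : ℝ => v ^ (s - 1) / (1 + v)) (Ioi 0) := by
  rw [← Ioc_union_Ioi_eq_Ioi zero_le_one]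
  have hm : Measurable fun v : ℝ => v ^ (s - 1) / (1 + v) := by fun_prop
  refine IntegrableOn.union ?_ ?_
  · have h : IntegrableOn (fun v : ℝ => v ^ (s - 1)) (Ioc 0 1) := by
      rw [← intervalIntegrable_iff_integrableOn_Ioc_of_le zero_le_one]
      exact intervalIntegral.intervalIntegrable_rpow' (by linarith)
    refine h.mono' hm.aestronglyMeasurable.restrict ?_
    refine (ae_restrict_iff' measurableSet_Ioc).2 (Filter.Eventually.of_forall fun v hv => ?_)
    have h0 : 0 ≤ v ^ (s - 1) := Real.rpow_nonneg hv.1.le _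
    rw [Real.norm_of_nonneg (div_nonneg h0 (by linarith [hv.1]))]
    exact div_le_self h0 (by linarith [hv.1])
  · have h : IntegrableOn (fun v : ℝ => v ^ (s - 2)) (Ioi 1) :=
      integrableOn_Ioi_rpow_of_lt (by linarith) one_pos
    refine h.mono' hm.aestronglyMeasurable.restrict ?_
    refine (ae_restrict_iff' measurableSet_Ioi).2 (Filter.Eventually.of_forall fun v hv => ?_)
    have hv1 : (1 : ℝ) < v := hv
    have hv0 : 0 < v := by linarith
    have h0 : 0 ≤ v ^ (s - 1) := Real.rpow_nonneg hv0.le _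
    rw [Real.norm_of_nonneg (div_nonneg h0 (by linarith))]
    have : v ^ (s - 2) = v ^ (s - 1) / v := by
      rw [← Real.rpow_sub_one hv0.ne']; congr 1; ring
    rw [this]
    gcongr
    linarith

/-- A majorant, uniform in `T`, for the integrand of the subordination formula. -/
theorem exists_saddle_majorant {s : ℝ} (hs : 1 / 2 ≤ s) (hs1 : s < 1) :
    ∃ C : ℝ, 0 ≤ C ∧ ∀ T : ℝ, ∃ φ : ℝ → ℝ, IntegrableOn φ (Ioi 0) ∧ ∫ v in Ioi 0, φ v ≤ C ∧
      ∀ v a : ℝ, 0 < v → v ≤ a →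
        v ^ (s - 1) * (1 / ‖(a + T * Complex.I : ℂ)‖ *
          Real.exp (-(a / (4 * ‖(a + T * Complex.I : ℂ)‖ ^ 2)))) ≤ φ v := by
  have hs0 : 0 < s := by linarith
  have hI := integrableOn_rpow_div_one_add hs0 hs1
  have hI0 : 0 ≤ ∫ v in Ioi (0 : ℝ), v ^ (s - 1) / (1 + v) :=
    setIntegral_nonneg measurableSet_Ioi fun v hv =>
      div_nonneg (Real.rpow_nonneg (le_of_lt hv) _) (by linarith [show (0 : ℝ) < v from hv])
  have hG : 0 < Real.Gamma s := Real.Gamma_pos_of_pos hs0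
  -- The first term controls `|T| ≤ a`, and also `a < |T|` when `|T| > 1`. The second controls `a <
  -- |T| ≤ 1`.
  refine ⟨8 * (∫ v in Ioi (0 : ℝ), v ^ (s - 1) / (1 + v)) + 8 ^ s * Real.Gamma s, by positivity,
    fun T => ?_⟩
  have hnorm : ∀ a : ℝ, ‖(a + T * Complex.I : ℂ)‖ ^ 2 = a ^ 2 + T ^ 2 := by
    intro a
    rw [← Complex.normSq_eq_norm_sq, Complex.normSq_add_mul_I]
  have hlow : ∀ a : ℝ, |a| ≤ ‖(a + T * Complex.I : ℂ)‖ := fun a => by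
    simpa using Complex.abs_re_le_norm (a + T * Complex.I : ℂ)
  have hlowT : ∀ a : ℝ, |T| ≤ ‖(a + T * Complex.I : ℂ)‖ := fun a => by
    simpa using Complex.abs_im_le_norm (a + T * Complex.I : ℂ)
  -- Here `|a + iT|² ≤ 2a²`, so the exponent is at least `1/(8a)`, and `exp(-x) ≤ 1/(1+x)` removes
  -- the singularity of `1/a` at zero.
  have hfar : ∀ v a : ℝ, 0 < v → v ≤ a → |T| ≤ a →
      1 / ‖(a + T * Complex.I : ℂ)‖ * Real.exp (-(a / (4 * ‖(a + T * Complex.I : ℂ)‖ ^ 2)))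
        ≤ 8 * (1 / (1 + v)) := by
    intro v a hv hva hTa
    have ha : 0 < a := by linarith
    have hB := hlow a
    rw [abs_of_pos ha] at hB
    have hT2 : T ^ 2 ≤ a ^ 2 := by rw [← sq_abs T]; gcongr
    have h1 : 1 / (8 * a) ≤ a / (4 * ‖(a + T * Complex.I : ℂ)‖ ^ 2) := by
      rw [hnorm, div_le_div_iff₀ (by positivity) (by positivity)]
      nlinarith
    have h2 : Real.exp (-(a / (4 * ‖(a + T * Complex.I : ℂ)‖ ^ 2))) ≤ 1 / (1 + 1 / (8 * a)) := by
      rw [Real.exp_neg, ← one_div]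
      have := Real.add_one_le_exp (a / (4 * ‖(a + T * Complex.I : ℂ)‖ ^ 2))
      apply one_div_le_one_div_of_le (by positivity)
      linarith
    calc _ ≤ 1 / a * (1 / (1 + 1 / (8 * a))) := by gcongr
      _ = 8 * (1 / (1 + 8 * a)) := by field_simp; ring
      _ ≤ _ := by gcongr; linarith
  by_cases hT : 0 < |T| ∧ |T| ≤ 1
  · obtain ⟨hT0, hT1⟩ := hT
    have hc : 0 < 1 / (8 * |T| ^ 2) := by positivity
    have hE := (integrableOn_rpow_mul_exp_neg_mul hs0 hc).const_mul (|T|⁻¹)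
    refine ⟨fun v => 8 * (v ^ (s - 1) / (1 + v)) +
      |T|⁻¹ * (v ^ (s - 1) * Real.exp (-(1 / (8 * |T| ^ 2)) * v)), (hI.const_mul 8).add hE, ?_, ?_⟩
    · rw [integral_add (hI.const_mul 8) hE, integral_const_mul, integral_const_mul,
        integral_rpow_mul_exp_neg_mul hs0 hc]
      refine add_le_add le_rfl ?_
      rw [← mul_assoc]
      refine mul_le_mul_of_nonneg_right ?_ hG.le
      rw [one_div, Real.inv_rpow (by positivity), Real.rpow_neg (by positivity), inv_inv,
        Real.mul_rpow (by positivity) (by positivity), ← Real.rpow_natCast, ← Real.rpow_mul hT0.le,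
        mul_left_comm, ← Real.rpow_neg_one, ← Real.rpow_add hT0]
      -- The remaining factor is `|T|^(2s-1)`, bounded for small `T` precisely because `s ≥ 1/2`.
      refine mul_le_of_le_one_right (by positivity) (Real.rpow_le_one hT0.le hT1 ?_)
      push_cast
      linarith
    · intro v a hv hva
      have hv1 : 0 ≤ v ^ (s - 1) := Real.rpow_nonneg hv.le _
      rcases le_or_gt |T| a with h | h
      · have := mul_le_mul_of_nonneg_left (hfar v a hv hva h) hv1
        have h3 : 0 ≤ |T|⁻¹ * (v ^ (s - 1) * Real.exp (-(1 / (8 * |T| ^ 2)) * v)) := by positivity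
        calc _ ≤ _ := this
          _ = 8 * (v ^ (s - 1) / (1 + v)) := by ring
          _ ≤ _ := by linarith
      · have ha : 0 < a := by linarith
        have hB := hlowT a
        have h1 : 1 / (8 * |T| ^ 2) * v ≤ a / (4 * ‖(a + T * Complex.I : ℂ)‖ ^ 2) := by
          have : a ^ 2 ≤ |T| ^ 2 := by gcongr
          rw [hnorm, ← sq_abs T, one_div_mul_eq_div]
          apply div_le_div₀ ha.le hva (by positivity)
          linarith
        have h3 : 0 ≤ 8 * (v ^ (s - 1) / (1 + v)) := by positivity
        calc _ ≤ v ^ (s - 1) * (|T|⁻¹ * Real.exp (-(1 / (8 * |T| ^ 2)) * v)) := by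
              rw [← one_div]
              gcongr
              linarith
          _ = |T|⁻¹ * (v ^ (s - 1) * Real.exp (-(1 / (8 * |T| ^ 2)) * v)) := by ring
          _ ≤ _ := by linarith
  · refine ⟨fun v => 8 * (v ^ (s - 1) / (1 + v)), hI.const_mul 8, ?_, ?_⟩
    · rw [integral_const_mul]
      have : 0 ≤ 8 ^ s * Real.Gamma s := by positivity
      linarith
    · intro v a hv hva
      have hv1 : 0 ≤ v ^ (s - 1) := Real.rpow_nonneg hv.le _
      have e : 8 * (v ^ (s - 1) / (1 + v)) = v ^ (s - 1) * (8 / (1 + v)) := by ring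
      change _ ≤ 8 * (v ^ (s - 1) / (1 + v))
      rw [e]
      refine mul_le_mul_of_nonneg_left ?_ hv1
      rcases le_or_gt |T| a with h | h
      · exact (hfar v a hv hva h).trans_eq (by ring)
      · have hT0 : 0 < |T| := by linarith
        have hT1 : 1 < |T| := by
          by_contra hcon
          exact hT ⟨hT0, not_lt.1 hcon⟩
        have hB := hlowT a
        calc _ ≤ 1 / |T| * 1 := by
              gcongr
              rw [Real.exp_le_one_iff, neg_nonpos]
              have : 0 < a := by linarith
              positivity
          _ ≤ 8 / (1 + v) := by
              rw [mul_one, div_le_div_iff₀ hT0 (by positivity)]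
              linarith

/-- Fubini for a weight `ρ` that is a superposition of the functions `κ · v`, `v > 0`. -/
theorem integral_mul_subordination {f : Plane → ℂ} (hf : AEStronglyMeasurable f)
    {κ : Plane → ℝ → ℝ} (hκm : Measurable (Function.uncurry κ))
    (hκ0 : ∀ x, ∀ v ∈ Ioi (0 : ℝ), 0 ≤ κ x v) {ρ : Plane → ℝ}
    (hκi : ∀ x, x ≠ 0 → IntegrableOn (κ x) (Ioi 0))
    (hρ : ∀ x, x ≠ 0 → ∫ v in Ioi 0, κ x v = ρ x)
    (hfρ : Integrable fun x => f x * (ρ x : ℂ)) :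
    ∫ x, f x * (ρ x : ℂ) = ∫ v in Ioi (0 : ℝ), ∫ x, f x * (κ x v : ℂ) := by
  -- The superposition is only assumed to converge away from the origin, a null set.
  have hne : ∀ᵐ x : Plane, x ≠ 0 := by simp [ae_iff]
  have hm : AEStronglyMeasurable (Function.uncurry fun x v => f x * (κ x v : ℂ))
      ((volume : Measure Plane).prod (volume.restrict (Ioi 0))) :=
    hf.comp_fst.mul (Complex.measurable_ofReal.comp hκm).aestronglyMeasurable
  have hint : Integrable (Function.uncurry fun x v => f x * (κ x v : ℂ))
      ((volume : Measure Plane).prod (volume.restrict (Ioi 0))) := by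
    rw [integrable_prod_iff hm]
    constructor
    · filter_upwards [hne] with x hx
      exact (Integrable.ofReal (𝕜 := ℂ) (hκi x hx)).const_mul (f x)
    · refine hfρ.norm.congr ?_
      filter_upwards [hne] with x hx
      have e1 : ∫ v in Ioi (0 : ℝ), ‖Function.uncurry (fun x v => f x * (κ x v : ℂ)) (x, v)‖ =
          ∫ v in Ioi (0 : ℝ), ‖f x‖ * κ x v := by
        refine setIntegral_congr_fun measurableSet_Ioi fun v hv => ?_
        simp [abs_of_nonneg (hκ0 x v hv)]
      rw [e1, integral_const_mul, hρ x hx, norm_mul, Complex.norm_real, Real.norm_of_nonneg]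
      rw [← hρ x hx]
      exact setIntegral_nonneg measurableSet_Ioi (hκ0 x)
  rw [← integral_integral_swap hint]
  refine integral_congr_ae ?_
  filter_upwards [hne] with x hx
  rw [integral_const_mul, integral_complex_ofReal, hρ x hx]

/-- A power times a Gaussian and a unimodular phase, as a superposition of Gaussians. -/
theorem integral_riesz_phase_eq {s ε : ℝ} (hs : 0 < s) (hs1 : s < 1) (hε : 0 < ε)
    {e : Plane → ℂ} (he : Measurable e) (he1 : ∀ η, ‖e η‖ ≤ 1) :
    ∫ η : Plane, ((‖η‖ ^ (-(2 * s)) * Real.exp (-ε * ‖η‖ ^ 2) : ℝ) : ℂ) * e η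
      = ((Real.Gamma s)⁻¹ : ℝ) * ∫ u in Ioi (0 : ℝ), ((u ^ (s - 1) : ℝ) : ℂ) *
          ∫ η : Plane, ((Real.exp (-(u + ε) * ‖η‖ ^ 2) : ℝ) : ℂ) * e η := by
  have hG : 0 < Real.Gamma s := Real.Gamma_pos_of_pos hs
  have hpow : ∀ η : Plane, (‖η‖ ^ 2) ^ (-s) = ‖η‖ ^ (-(2 * s)) := by
    intro η
    rw [← Real.rpow_natCast, ← Real.rpow_mul (norm_nonneg _)]
    congr 1; push_cast; ring
  have key := integral_mul_subordination
    (f := fun η : Plane => ((Real.exp (-ε * ‖η‖ ^ 2) : ℝ) : ℂ) * e η)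
    (κ := fun η u => u ^ (s - 1) * Real.exp (-‖η‖ ^ 2 * u))
    (ρ := fun η => ‖η‖ ^ (-(2 * s)) * Real.Gamma s)
    (by fun_prop) (by fun_prop)
    (fun η u hu => mul_nonneg (Real.rpow_nonneg (le_of_lt hu) _) (Real.exp_pos _).le)
    (fun η hη => integrableOn_rpow_mul_exp_neg_mul hs (by positivity))
    (fun η hη => by
      rw [integral_rpow_mul_exp_neg_mul hs (show 0 < ‖η‖ ^ 2 by positivity), hpow])
    (by
      have h := (integrable_norm_rpow_mul_exp_neg (p := 2 * s) (by linarith) hε).mul_const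
        (Real.Gamma s)
      refine Integrable.mono' h (by fun_prop) (Filter.Eventually.of_forall fun η => ?_)
      have h1 := he1 η
      rw [norm_mul, norm_mul, Complex.norm_real, Complex.norm_real,
        Real.norm_of_nonneg (by positivity), Real.norm_of_nonneg (by positivity)]
      calc _ ≤ Real.exp (-ε * ‖η‖ ^ 2) * 1 * (‖η‖ ^ (-(2 * s)) * Real.Gamma s) := by gcongr
        _ = _ := by ring)
  have hGc : (Real.Gamma s : ℂ) ≠ 0 := by exact_mod_cast hG.ne'
  calc _ = ((Real.Gamma s)⁻¹ : ℝ) * ∫ η : Plane, ((Real.exp (-ε * ‖η‖ ^ 2) : ℝ) : ℂ) * e η *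
        ((‖η‖ ^ (-(2 * s)) * Real.Gamma s : ℝ) : ℂ) := by
        rw [← integral_const_mul]
        congr 1
        ext η
        push_cast
        field_simp
    _ = _ := by
        rw [key]
        congr 2
        ext u
        rw [← integral_const_mul]
        congr 1
        ext η
        rw [show -(u + ε) * ‖η‖ ^ 2 = -‖η‖ ^ 2 * u + -ε * ‖η‖ ^ 2 by ring, Real.exp_add]
        push_cast
        ring

/-- The kernel of the flow composed with its adjoint: it is dominated by the Riesz kernel of
order `2 s`, uniformly in time and in the Gaussian regularisation. -/
theorem exists_norm_integral_riesz_saddle_le {s : ℝ} (hs : 1 / 2 ≤ s) (hs1 : s < 1) :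
    ∃ C : ℝ, 0 ≤ C ∧ ∀ (ε t : ℝ) (z : Plane), 0 < ε → z ≠ 0 →
      ‖∫ η : Plane, ((‖η‖ ^ (-(2 * s)) * Real.exp (-ε * ‖η‖ ^ 2) : ℝ) : ℂ) *
        Complex.exp (Complex.I * (inner ℝ z η : ℝ)
          - Complex.I * ((t * (η 0 ^ 2 - η 1 ^ 2) : ℝ) : ℂ))‖ ≤ C * ‖z‖ ^ (2 * s - 2) := by
  have hs0 : 0 < s := by linarith
  obtain ⟨C, hC, H⟩ := exists_saddle_majorant hs hs1
  have hG : 0 < Real.Gamma s := Real.Gamma_pos_of_pos hs0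
  refine ⟨(Real.Gamma s)⁻¹ * (Real.pi * C), by positivity, fun ε t z hε hz => ?_⟩
  have hz0 : 0 < ‖z‖ := norm_pos_iff.2 hz
  set R : ℝ := ‖z‖ ^ 2 with hR
  have hR0 : 0 < R := by positivity
  -- Scaling by `R = |z|²` normalizes the frequency integral to `|z| = 1` and turns the time into `t
  -- / R`. The regularization `ε` then only replaces `v = u/R` by a larger `a = (u+ε)/R`, which the
  -- majorant allows.
  obtain ⟨φ, hφ, hφC, hφle⟩ := H (t / R)
  rw [integral_riesz_phase_eq hs0 hs1 hε (by fun_prop) (fun η => by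
    rw [← mul_sub, ← Complex.ofReal_sub, mul_comm, Complex.norm_exp_ofReal_mul_I])]
  rw [norm_mul, Complex.norm_real, Real.norm_of_nonneg (by positivity)]
  have hbound : ∀ u ∈ Ioi (0 : ℝ), ‖((u ^ (s - 1) : ℝ) : ℂ) *
      ∫ η : Plane, ((Real.exp (-(u + ε) * ‖η‖ ^ 2) : ℝ) : ℂ) *
        Complex.exp (Complex.I * (inner ℝ z η : ℝ)
          - Complex.I * ((t * (η 0 ^ 2 - η 1 ^ 2) : ℝ) : ℂ))‖
      ≤ (Real.pi * R ^ (s - 2)) * φ (R⁻¹ * u) := by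
    intro u hu
    have hu0 : (0 : ℝ) < u := hu
    have e1 : ∀ η : Plane, ((Real.exp (-(u + ε) * ‖η‖ ^ 2) : ℝ) : ℂ) *
        Complex.exp (Complex.I * (inner ℝ z η : ℝ)
          - Complex.I * ((t * (η 0 ^ 2 - η 1 ^ 2) : ℝ) : ℂ)) =
        Complex.exp (-((u + ε) * ‖η‖ ^ 2 : ℝ) + Complex.I * (inner ℝ z η : ℝ)
          - Complex.I * ((t * (η 0 ^ 2 - η 1 ^ 2) : ℝ) : ℂ)) := by
      intro η
      rw [Complex.ofReal_exp, ← Complex.exp_add]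
      congr 1
      push_cast
      ring
    simp only [e1]
    rw [norm_mul, norm_integral_gaussian_saddle (by linarith : 0 < u + ε), Complex.norm_real,
      Real.norm_of_nonneg (by positivity)]
    have h := hφle (R⁻¹ * u) (R⁻¹ * (u + ε)) (by positivity) (by gcongr; linarith)
    have hn : ‖((R⁻¹ * (u + ε) : ℝ) + (t / R : ℝ) * Complex.I : ℂ)‖ =
        R⁻¹ * ‖((u + ε : ℝ) + t * Complex.I : ℂ)‖ := by
      rw [show ((R⁻¹ * (u + ε) : ℝ) + (t / R : ℝ) * Complex.I : ℂ) =
        (R⁻¹ : ℝ) * ((u + ε : ℝ) + t * Complex.I : ℂ) by push_cast; ring, norm_mul,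
        Complex.norm_real, Real.norm_of_nonneg (by positivity)]
    rw [hn] at h
    set n := ‖((u + ε : ℝ) + t * Complex.I : ℂ)‖ with hndef
    have hn0 : 0 < n := by
      rw [hndef, norm_pos_iff]; intro h0
      have := congrArg Complex.re h0
      simp at this; linarith
    refine le_trans (le_of_eq ?_) (mul_le_mul_of_nonneg_left h (by positivity))
    have h1 : R⁻¹ * (u + ε) / (4 * (R⁻¹ * n) ^ 2) = (u + ε) * R / (4 * n ^ 2) := by
      field_simp
    have h2 : (R⁻¹ * u) ^ (s - 1) = R ^ (1 - s) * u ^ (s - 1) := by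
      rw [Real.mul_rpow (by positivity) hu0.le, Real.inv_rpow hR0.le, ← Real.rpow_neg hR0.le,
        neg_sub]
    have h3 : R ^ (s - 2) * R ^ (1 - s) = R⁻¹ := by
      rw [← Real.rpow_add hR0, ← Real.rpow_neg_one]; congr 1; ring
    rw [h1, h2]
    calc u ^ (s - 1) * (Real.pi / n * Real.exp (-((u + ε) * R / (4 * n ^ 2))))
        = Real.pi * (R⁻¹ * R) * u ^ (s - 1) * (1 / n * Real.exp (-((u + ε) * R / (4 * n ^ 2)))) := by
          rw [inv_mul_cancel₀ hR0.ne']; ring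
      _ = Real.pi * (R ^ (s - 2) * R ^ (1 - s) * R) * u ^ (s - 1) *
          (1 / n * Real.exp (-((u + ε) * R / (4 * n ^ 2)))) := by rw [h3]
      _ = _ := by field_simp
  have hφi : IntegrableOn (fun u => (Real.pi * R ^ (s - 2)) * φ (R⁻¹ * u)) (Ioi 0) := by
    have h := (integrableOn_Ioi_comp_mul_left_iff φ 0 (inv_pos.2 hR0)).2 (by simpa using hφ)
    exact h.const_mul _
  have hle := norm_integral_le_of_norm_le hφi
    ((ae_restrict_iff' measurableSet_Ioi).2 (Filter.Eventually.of_forall hbound))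
  rw [integral_const_mul, integral_comp_mul_left_Ioi φ 0 (inv_pos.2 hR0), mul_zero, inv_inv,
    smul_eq_mul] at hle
  rw [mul_assoc]
  gcongr
  refine hle.trans ?_
  calc Real.pi * R ^ (s - 2) * (R * ∫ v in Ioi 0, φ v)
      ≤ Real.pi * R ^ (s - 2) * (R * C) := by gcongr
    _ = Real.pi * C * (R ^ (s - 2) * R) := by ring
    _ = Real.pi * C * ‖z‖ ^ (2 * s - 2) := by
      congr 1
      rw [← Real.rpow_add_one hR0.ne', hR, ← Real.rpow_natCast, ← Real.rpow_mul hz0.le]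
      congr 1; push_cast; ring

/-! ### Fourier inversion on `L²` and the transform of the Riesz kernel -/

/-- The inverse Fourier transform on `L²` is given by the integral on `L¹ ∩ L²`. -/
theorem coeFn_fourierInv_toLp {f : Plane → ℂ} (h1 : Integrable f) (h2 : MemLp f 2) :
    (𝓕⁻ (h2.toLp f) : Lp ℂ 2 (volume : Measure Plane)) =ᵐ[volume] 𝓕⁻ f := by
  have hcont : Continuous (𝓕⁻ f) := by
    rw [Real.fourierInv_eq_fourier_comp_neg]
    exact VectorFourier.fourierIntegral_continuous Real.continuous_fourierChar
      (by exact continuous_inner) h1.comp_neg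
  refine ae_eq_of_integral_contDiff_smul_eq
    ((Lp.memLp _).locallyIntegrable (by norm_num)) hcont.locallyIntegrable fun g hg hgc => ?_
  have hc : HasCompactSupport fun y => ((g y : ℝ) : ℂ) :=
    hgc.comp_left (g := ((↑) : ℝ → ℂ)) Complex.ofReal_zero
  have hd : ContDiff ℝ ∞ fun y => ((g y : ℝ) : ℂ) := Complex.ofRealCLM.contDiff.comp hg
  let φ : 𝓢(Plane, ℂ) := hc.toSchwartzMap hd
  -- Both inverse transforms are tested against smooth compactly supported functions. The `L²` one
  -- is compatible with tempered distributions, and the integral one is moved onto the test function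
  -- by Fubini.
  have key := congrArg (fun T => T φ) (Lp.fourierInv_toTemperedDistribution_eq (h2.toLp f))
  simp only [TemperedDistribution.fourierInv_apply, Lp.toTemperedDistribution_apply] at key
  have e1 : ∫ x, g x • (𝓕⁻ (h2.toLp f) : Lp ℂ 2 (volume : Measure Plane)) x =
      ∫ x, φ x • (𝓕⁻ (h2.toLp f) : Lp ℂ 2 (volume : Measure Plane)) x := by
    congr 1
  have e2 : ∫ x, (𝓕⁻ φ) x • (h2.toLp f) x = ∫ x, (𝓕⁻ φ) x • f x := by
    refine integral_congr_ae ?_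
    filter_upwards [h2.coeFn_toLp] with x hx
    rw [hx]
  rw [e1, ← key, e2]
  have flip := VectorFourier.integral_fourierIntegral_smul_eq_flip (L := -innerₗ Plane)
    (μ := volume) (ν := volume) Real.continuous_fourierChar
    (by simpa using! continuous_inner.neg) φ.integrable h1
  rw [SchwartzMap.fourierInv_coe]
  refine flip.trans ?_
  congr 1
  ext x
  change φ x • VectorFourier.fourierIntegral _ _ (-innerₗ Plane).flip f x =
    φ x • VectorFourier.fourierIntegral _ _ (-innerₗ Plane) f x
  congr 2
  ext a b
  simp [real_inner_comm]

/-- The substitution `v ↦ 1/v` in the Gamma integral. This form appears because the transform of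
`exp(-v|y|²)` is `(π/v) exp(-π²|η|²/v)`. -/
theorem integral_inv_rpow_mul_exp_neg_div {q c : ℝ} (hq : 0 < q) (hc : 0 < c) :
    IntegrableOn (fun v : ℝ => v ^ (-q - 1) * Real.exp (-c / v)) (Ioi 0) ∧
      ∫ v in Ioi (0 : ℝ), v ^ (-q - 1) * Real.exp (-c / v) = c ^ (-q) * Real.Gamma q := by
  have h1 := integrableOn_rpow_mul_exp_neg_mul hq hc
  have h2 := integral_rpow_mul_exp_neg_mul hq hc
  have e : ∀ v ∈ Ioi (0 : ℝ), (|(-1 : ℝ)| * v ^ ((-1 : ℝ) - 1)) •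
      ((v ^ (-1 : ℝ)) ^ (q - 1) * Real.exp (-c * v ^ (-1 : ℝ))) =
      v ^ (-q - 1) * Real.exp (-c / v) := by
    intro v hv
    have hv0 : (0 : ℝ) < v := hv
    rw [← Real.rpow_mul hv0.le, Real.rpow_neg_one, smul_eq_mul, ← mul_assoc, abs_neg, abs_one,
      one_mul, ← Real.rpow_add hv0, div_eq_mul_inv]
    congr 2
    ring
  constructor
  · refine IntegrableOn.congr_fun ?_ e measurableSet_Ioi
    exact (integrableOn_Ioi_comp_rpow_iff _ (by norm_num : (-1 : ℝ) ≠ 0)).2 h1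
  · rw [← h2, ← integral_comp_rpow_Ioi (fun u : ℝ => u ^ (q - 1) * Real.exp (-c * u))
      (by norm_num : (-1 : ℝ) ≠ 0)]
    exact (setIntegral_congr_fun measurableSet_Ioi e).symm

/-- The constant in the Fourier transform of the Riesz kernel. -/
noncomputable def rieszConst (s : ℝ) : ℝ :=
  Real.pi ^ (1 - s) * Real.Gamma (s / 2) / Real.Gamma (1 - s / 2)

/-- The Fourier transform of the Riesz kernel `|x|^(s-2)` is a multiple of `|η|^(-s)`. -/
theorem integral_fourier_mul_rieszKernel {s : ℝ} (hs : 0 < s) (hs1 : s < 1) {φ : Plane → ℂ}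
    (hφ : Integrable φ) (h1 : Integrable fun y => 𝓕 φ y * (rieszKernel s y : ℂ))
    (h2 : Integrable fun η => φ η * ((‖η‖ ^ (-s) : ℝ) : ℂ)) :
    ∫ y, 𝓕 φ y * (rieszKernel s y : ℂ) =
      (rieszConst s : ℂ) * ∫ η, φ η * ((‖η‖ ^ (-s) : ℝ) : ℂ) := by
  have hp : 0 < 1 - s / 2 := by linarith
  have hG1 : 0 < Real.Gamma (1 - s / 2) := Real.Gamma_pos_of_pos hp
  have hcont : Continuous (𝓕 φ) :=
    VectorFourier.fourierIntegral_continuous Real.continuous_fourierChar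
      (by exact continuous_inner) hφ
  have A := integral_mul_subordination (f := 𝓕 φ)
    (κ := fun y v => v ^ ((1 - s / 2) - 1) * Real.exp (-‖y‖ ^ 2 * v))
    (ρ := fun y => rieszKernel s y * Real.Gamma (1 - s / 2))
    hcont.aestronglyMeasurable (by fun_prop)
    (fun η u hu => mul_nonneg (Real.rpow_nonneg (le_of_lt hu) _) (Real.exp_pos _).le)
    (fun η hη => integrableOn_rpow_mul_exp_neg_mul hp (by positivity))
    (fun η hη => by
      rw [integral_rpow_mul_exp_neg_mul hp (show 0 < ‖η‖ ^ 2 by positivity), rieszKernel,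
        ← Real.rpow_natCast, ← Real.rpow_mul (norm_nonneg _)]
      congr 2; push_cast; ring)
    (by
      refine (h1.mul_const (Real.Gamma (1 - s / 2) : ℂ)).congr (Filter.Eventually.of_forall ?_)
      intro y; push_cast; ring)
  have B := integral_mul_subordination (f := φ)
    (κ := fun η v => Real.pi * (v ^ (-(s / 2) - 1) * Real.exp (-(Real.pi ^ 2 * ‖η‖ ^ 2) / v)))
    (ρ := fun η => ‖η‖ ^ (-s) * (Real.pi ^ (1 - s) * Real.Gamma (s / 2)))
    hφ.aestronglyMeasurable (by fun_prop)
    (fun η u hu => mul_nonneg Real.pi_pos.le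
      (mul_nonneg (Real.rpow_nonneg (le_of_lt hu) _) (Real.exp_pos _).le))
    (fun η hη => (integral_inv_rpow_mul_exp_neg_div (half_pos hs)
      (show 0 < Real.pi ^ 2 * ‖η‖ ^ 2 by positivity)).1.const_mul _)
    (fun η hη => by
      rw [integral_const_mul, (integral_inv_rpow_mul_exp_neg_div (half_pos hs)
        (show 0 < Real.pi ^ 2 * ‖η‖ ^ 2 by positivity)).2,
        Real.mul_rpow (by positivity) (by positivity), ← Real.rpow_natCast, ← Real.rpow_natCast,
        ← Real.rpow_mul (norm_nonneg _), ← Real.rpow_mul Real.pi_pos.le, sub_eq_add_neg 1 s,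
        Real.rpow_add Real.pi_pos, Real.rpow_one]
      push_cast
      rw [show (2 : ℝ) * (-(s / 2)) = -s by ring]
      ring)
    (by
      refine (h2.mul_const ((Real.pi ^ (1 - s) * Real.Gamma (s / 2) : ℝ) : ℂ)).congr
        (Filter.Eventually.of_forall ?_)
      intro y; push_cast; ring)
  -- `A` and `B` write the two sides as superpositions over the same parameter `v`. For each `v` the
  -- integrands agree by the multiplication formula and the transform of a Gaussian.
  have C : ∀ v ∈ Ioi (0 : ℝ),
      ∫ y, 𝓕 φ y * ((v ^ ((1 - s / 2) - 1) * Real.exp (-‖y‖ ^ 2 * v) : ℝ) : ℂ) =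
      ∫ η, φ η * ((Real.pi * (v ^ (-(s / 2) - 1) *
        Real.exp (-(Real.pi ^ 2 * ‖η‖ ^ 2) / v)) : ℝ) : ℂ) := by
    intro v hv
    have hv0 : (0 : ℝ) < v := hv
    have hvc : (v : ℂ) ≠ 0 := by exact_mod_cast hv0.ne'
    have hb : 0 < ((v : ℝ) : ℂ).re := by simpa using hv0
    have hg : Integrable fun y : Plane => Complex.exp (-(v : ℂ) * ‖y‖ ^ 2) := by
      simpa using GaussianFourier.integrable_cexp_neg_mul_sq_norm_add hb 0 (0 : Plane)
    have flip := VectorFourier.integral_fourierIntegral_smul_eq_flip (L := innerₗ Plane)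
      (μ := volume) (ν := volume) Real.continuous_fourierChar
      (by exact continuous_inner) hφ hg
    have hflip : ∫ y, 𝓕 φ y * Complex.exp (-(v : ℂ) * ‖y‖ ^ 2) =
        ∫ η, φ η * 𝓕 (fun y : Plane => Complex.exp (-(v : ℂ) * ‖y‖ ^ 2)) η := by
      refine flip.trans ?_
      congr 1
      ext x
      change φ x • VectorFourier.fourierIntegral Real.fourierChar volume (innerₗ Plane).flip
          (fun y : Plane => Complex.exp (-(v : ℂ) * ‖y‖ ^ 2)) x =
        φ x • VectorFourier.fourierIntegral Real.fourierChar volume (innerₗ Plane)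
          (fun y : Plane => Complex.exp (-(v : ℂ) * ‖y‖ ^ 2)) x
      congr 2
      ext a b
      simp
    have e1 : ∫ y, 𝓕 φ y * ((v ^ ((1 - s / 2) - 1) * Real.exp (-‖y‖ ^ 2 * v) : ℝ) : ℂ) =
        ((v ^ (-(s / 2)) : ℝ) : ℂ) * ∫ y, 𝓕 φ y * Complex.exp (-(v : ℂ) * ‖y‖ ^ 2) := by
      rw [← integral_const_mul]
      congr 1
      ext y
      rw [show (1 - s / 2) - 1 = -(s / 2) by ring]
      push_cast
      rw [show (-(v : ℂ) * ‖y‖ ^ 2) = -‖y‖ ^ 2 * v by ring]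
      ring
    rw [e1, hflip, ← integral_const_mul]
    congr 1
    ext η
    rw [fourier_gaussian_innerProductSpace hb, finrank_euclideanSpace_fin]
    rw [Real.rpow_sub_one hv0.ne']
    push_cast
    rw [div_self two_ne_zero, Complex.cpow_one,
      show (-(Real.pi : ℂ) ^ 2 * ‖η‖ ^ 2 / v) = -(Real.pi ^ 2 * ‖η‖ ^ 2) / v by ring]
    ring
  rw [setIntegral_congr_fun measurableSet_Ioi C, ← B] at A
  have hG1c : (Real.Gamma (1 - s / 2) : ℂ) ≠ 0 := by exact_mod_cast hG1.ne'
  have A' : (∫ y, 𝓕 φ y * (rieszKernel s y : ℂ)) * (Real.Gamma (1 - s / 2) : ℂ) =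
      (∫ η, φ η * ((‖η‖ ^ (-s) : ℝ) : ℂ)) * ((Real.pi ^ (1 - s) * Real.Gamma (s / 2) : ℝ) : ℂ) := by
    rw [← integral_mul_const, ← integral_mul_const]
    refine Eq.trans ?_ (A.trans ?_)
    · congr 1; ext y; push_cast; ring
    · congr 1; ext y; push_cast; ring
  rw [rieszConst, Complex.ofReal_div, div_mul_eq_mul_div, eq_div_iff hG1c, A', mul_comm]

/-! ### The mollified Riesz kernel and its multiplier -/

/-- The convolution `G_N * I_s`. -/
noncomputable def rieszGauss (s : ℝ) (N : ℕ) (z : Plane) : ℝ :=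
  ∫ y, gaussianScale N (z - y) * rieszKernel s y

/-- The Fourier transform of `G_N * I_s`, with the normalisation `exp (-2πi x·η)`. -/
noncomputable def rieszMult (s : ℝ) (N : ℕ) (η : Plane) : ℝ :=
  Real.pi * rieszConst s * (‖η‖ ^ (-s) * Real.exp (-(Real.pi ^ 2 / (N : ℝ) ^ 2) * ‖η‖ ^ 2))

@[fun_prop]
theorem measurable_gaussianScale (N : ℕ) : Measurable (gaussianScale N) := by
  unfold gaussianScale; fun_prop

@[fun_prop]
theorem measurable_rieszKernel (s : ℝ) : Measurable (rieszKernel s) := by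
  unfold rieszKernel; fun_prop

@[fun_prop]
theorem measurable_rieszMult (s : ℝ) (N : ℕ) : Measurable (rieszMult s N) := by
  unfold rieszMult; fun_prop

theorem gaussianScale_pos {N : ℕ} (hN : 1 ≤ N) (x : Plane) : 0 < gaussianScale N x := by
  have : (0 : ℝ) < N := by exact_mod_cast hN
  unfold gaussianScale; positivity

theorem gaussianScale_eq (N : ℕ) (x : Plane) :
    gaussianScale N x = (N : ℝ) ^ 2 * Real.exp (-(N : ℝ) ^ 2 * ‖x‖ ^ 2) := by
  rw [gaussianScale, norm_smul, mul_pow, Real.norm_eq_abs, sq_abs, neg_mul]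

theorem rieszKernel_nonneg (s : ℝ) (x : Plane) : 0 ≤ rieszKernel s x :=
  Real.rpow_nonneg (norm_nonneg _) _

theorem rieszConst_nonneg {s : ℝ} (hs : 0 < s) (hs1 : s < 1) : 0 ≤ rieszConst s := by
  have h1 : 0 < Real.Gamma (s / 2) := Real.Gamma_pos_of_pos (by linarith)
  have h2 : 0 < Real.Gamma (1 - s / 2) := Real.Gamma_pos_of_pos (by linarith)
  have := Real.pi_pos
  unfold rieszConst; positivity

theorem integrable_rieszMult {s : ℝ} (hs1 : s < 1) {N : ℕ} (hN : 1 ≤ N) :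
    Integrable (rieszMult s N) := by
  have : (0 : ℝ) < N := by exact_mod_cast hN
  exact (integrable_norm_rpow_mul_exp_neg (by linarith) (by positivity)).const_mul _

/-- Squaring produces `|η|^(-2s)`, integrable at the origin of the plane because `2s < 2`; the
Gaussian handles infinity. -/
theorem memLp_rieszMult {s : ℝ} (hs1 : s < 1) {N : ℕ} (hN : 1 ≤ N) :
    MemLp (rieszMult s N) 2 := by
  have : (0 : ℝ) < N := by exact_mod_cast hN
  rw [memLp_two_iff_integrable_sq (measurable_rieszMult s N).aestronglyMeasurable]
  have e : ∀ η : Plane, rieszMult s N η ^ 2 = (Real.pi * rieszConst s) ^ 2 *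
      (‖η‖ ^ (-(2 * s)) * Real.exp (-(2 * (Real.pi ^ 2 / (N : ℝ) ^ 2)) * ‖η‖ ^ 2)) := by
    intro η
    rw [rieszMult, mul_pow, mul_pow (‖η‖ ^ (-s)), ← Real.rpow_natCast (‖η‖ ^ (-s)),
      ← Real.rpow_mul (norm_nonneg _), ← Real.exp_nat_mul]
    push_cast
    ring_nf
  simp only [e]
  exact (integrable_norm_rpow_mul_exp_neg (by linarith) (by positivity)).const_mul _

theorem integrable_gaussianScale_mul_rieszKernel {s : ℝ} (hs : 0 < s) (hs1 : s < 1) {N : ℕ}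
    (hN : 1 ≤ N) (z : Plane) :
    Integrable fun y => gaussianScale N (z - y) * rieszKernel s y := by
  have hN0 : (0 : ℝ) < N := by exact_mod_cast hN
  have hg : Integrable (gaussianScale N) := by
    have h := (integrable_norm_rpow_mul_exp_neg (p := 0) (by norm_num)
      (show 0 < (N : ℝ) ^ 2 by positivity)).const_mul ((N : ℝ) ^ 2)
    refine h.congr (Filter.Eventually.of_forall fun η => ?_)
    simp [gaussianScale_eq]
  have h1 : Integrable fun y => gaussianScale N (z - y) := hg.comp_sub_left z
  -- Near the origin the Gaussian is bounded and the singularity is integrable; the factor `exp 1`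
  -- compensates for `exp(-|y|²)` on the unit ball. Outside it the Riesz kernel is at most one and
  -- the first majorant suffices.
  have h2 := (integrable_norm_rpow_mul_exp_neg (p := 2 - s) (by linarith) one_pos).const_mul
    ((N : ℝ) ^ 2 * Real.exp 1)
  refine (h1.add h2).mono' (by fun_prop) (Filter.Eventually.of_forall fun y => ?_)
  have hG := gaussianScale_pos hN (z - y)
  have hI := rieszKernel_nonneg s y
  rw [Real.norm_of_nonneg (by positivity)]
  simp only [Pi.add_apply]
  rcases le_or_gt ‖y‖ 1 with h | h
  · have e1 : gaussianScale N (z - y) ≤ (N : ℝ) ^ 2 := by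
      rw [gaussianScale_eq]
      refine mul_le_of_le_one_right (by positivity) ?_
      rw [Real.exp_le_one_iff, neg_mul, neg_nonpos]
      positivity
    have e2 : 1 ≤ Real.exp 1 * Real.exp (-1 * ‖y‖ ^ 2) := by
      rw [← Real.exp_add, Real.one_le_exp_iff]
      nlinarith [norm_nonneg y]
    have e3 : rieszKernel s y = ‖y‖ ^ (-(2 - s)) := by rw [rieszKernel, neg_sub]
    calc _ ≤ (N : ℝ) ^ 2 * rieszKernel s y := by gcongr
      _ ≤ (N : ℝ) ^ 2 * rieszKernel s y * (Real.exp 1 * Real.exp (-1 * ‖y‖ ^ 2)) :=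
        le_mul_of_one_le_right (by positivity) e2
      _ = (N : ℝ) ^ 2 * Real.exp 1 * (‖y‖ ^ (-(2 - s)) * Real.exp (-1 * ‖y‖ ^ 2)) := by
        rw [e3]; ring
      _ ≤ _ := by linarith
  · have e1 : rieszKernel s y ≤ 1 := Real.rpow_le_one_of_one_le_of_nonpos h.le (by linarith)
    have : 0 ≤ (N : ℝ) ^ 2 * Real.exp 1 * (‖y‖ ^ (-(2 - s)) * Real.exp (-1 * ‖y‖ ^ 2)) := by
      positivity
    calc _ ≤ gaussianScale N (z - y) := mul_le_of_le_one_right hG.le e1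
      _ ≤ _ := by linarith

theorem rieszGauss_neg (s : ℝ) (N : ℕ) (z : Plane) : rieszGauss s N (-z) = rieszGauss s N z := by
  rw [rieszGauss, ← integral_neg_eq_self, rieszGauss]
  congr 1
  ext y
  rw [rieszKernel, rieszKernel, gaussianScale_eq, gaussianScale_eq, norm_neg, ← norm_neg (z - y)]
  rw [show -(z - y) = -z - -y by abel]

/-- `G_N * I_s` as an inverse Fourier integral. -/
theorem rieszGauss_eq {s : ℝ} (hs : 0 < s) (hs1 : s < 1) {N : ℕ} (hN : 1 ≤ N) (z : Plane) :
    (rieszGauss s N z : ℂ) =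
      ∫ η, Complex.exp (2 * Real.pi * Complex.I * (inner ℝ z η : ℝ)) * (rieszMult s N η : ℂ) := by
  have hN0 : (0 : ℝ) < N := by exact_mod_cast hN
  have hNc : (N : ℂ) ≠ 0 := by exact_mod_cast hN0.ne'
  have hpc : (Real.pi : ℂ) ≠ 0 := by exact_mod_cast Real.pi_pos.ne'
  have hb : 0 < ((Real.pi ^ 2 / (N : ℝ) ^ 2 : ℝ) : ℂ).re := by
    rw [Complex.ofReal_re]; positivity
  set b : ℂ := ((Real.pi ^ 2 / (N : ℝ) ^ 2 : ℝ) : ℂ) with hbdef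
  -- A modulated Gaussian, chosen so that its Fourier transform is `π⁻¹ G_N(z - y)`.
  let φ : Plane → ℂ := fun η =>
    Complex.exp (-b * ‖η‖ ^ 2 + 2 * Real.pi * Complex.I * (inner ℝ z η : ℝ))
  have hφ : Integrable φ :=
    GaussianFourier.integrable_cexp_neg_mul_sq_norm_add hb (2 * Real.pi * Complex.I) z
  have hF : ∀ y, 𝓕 φ y = ((Real.pi⁻¹ * gaussianScale N (z - y) : ℝ) : ℂ) := by
    intro y
    rw [fourier_gaussian_innerProductSpace' hb, finrank_euclideanSpace_fin, gaussianScale_eq,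
      hbdef]
    push_cast
    rw [div_self two_ne_zero, Complex.cpow_one, ← mul_assoc]
    congr 1
    · field_simp
    · congr 1; field_simp
  have hmul : ∀ η, (Real.pi * rieszConst s : ℂ) * (φ η * ((‖η‖ ^ (-s) : ℝ) : ℂ)) =
      Complex.exp (2 * Real.pi * Complex.I * (inner ℝ z η : ℝ)) * (rieszMult s N η : ℂ) := by
    intro η
    simp only [φ, rieszMult, Complex.exp_add, hbdef]
    push_cast
    ring
  have h1 : Integrable fun y => 𝓕 φ y * (rieszKernel s y : ℂ) := by
    have h : Integrable fun y =>
        ((Real.pi⁻¹ * (gaussianScale N (z - y) * rieszKernel s y) : ℝ) : ℂ) :=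
      ((integrable_gaussianScale_mul_rieszKernel hs hs1 hN z).const_mul Real.pi⁻¹).ofReal
    refine h.congr (Filter.Eventually.of_forall fun y => ?_)
    simp only [hF]
    push_cast
    ring
  have h2 : Integrable fun η => φ η * ((‖η‖ ^ (-s) : ℝ) : ℂ) := by
    refine (integrable_norm_rpow_mul_exp_neg (p := s) (b := Real.pi ^ 2 / (N : ℝ) ^ 2)
      (by linarith) (by positivity)).mono' (by fun_prop) (Filter.Eventually.of_forall fun η => ?_)
    rw [norm_mul, Complex.norm_real, Real.norm_of_nonneg (by positivity), mul_comm]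
    refine le_of_eq ?_
    congr 1
    simp only [φ, Complex.norm_exp, hbdef]
    congr 1
    simp [← Complex.ofReal_pow]
  have key := integral_fourier_mul_rieszKernel hs hs1 hφ h1 h2
  have e1 : (rieszGauss s N z : ℂ) = Real.pi * ∫ y, 𝓕 φ y * (rieszKernel s y : ℂ) := by
    rw [rieszGauss, ← integral_complex_ofReal, ← integral_const_mul]
    congr 1
    ext y
    rw [hF]
    push_cast
    field_simp
  rw [e1, key, ← mul_assoc, ← integral_const_mul]
  congr 1
  ext η
  exact hmul η

theorem norm_exp_two_pi_inner (x η : Plane) :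
    ‖Complex.exp (2 * Real.pi * Complex.I * (inner ℝ x η : ℝ))‖ = 1 := by
  rw [show 2 * Real.pi * Complex.I * (inner ℝ x η : ℝ) =
    ((2 * Real.pi * inner ℝ x η : ℝ) : ℂ) * Complex.I by push_cast; ring,
    Complex.norm_exp_ofReal_mul_I]

theorem memLp_phase_mul_rieszMult {s : ℝ} (hs1 : s < 1) {N : ℕ} (hN : 1 ≤ N) (x : Plane) :
    MemLp (fun η => Complex.exp (2 * Real.pi * Complex.I * (inner ℝ x η : ℝ)) *
      (rieszMult s N η : ℂ)) 2 := by
  refine (memLp_rieszMult hs1 hN).of_le (by fun_prop) (Filter.Eventually.of_forall fun η => ?_)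
  rw [norm_mul, norm_exp_two_pi_inner, one_mul, Complex.norm_real]

theorem integrable_phase_mul_rieszMult {s : ℝ} (hs1 : s < 1) {N : ℕ} (hN : 1 ≤ N) (x : Plane) :
    Integrable (fun η => Complex.exp (2 * Real.pi * Complex.I * (inner ℝ x η : ℝ)) *
      (rieszMult s N η : ℂ)) := by
  refine (integrable_rieszMult hs1 hN).mono (by fun_prop) (Filter.Eventually.of_forall fun η => ?_)
  rw [norm_mul, norm_exp_two_pi_inner, one_mul, Complex.norm_real]

theorem fourierInv_phase_mul_rieszMult {s : ℝ} (hs : 0 < s) (hs1 : s < 1) {N : ℕ} (hN : 1 ≤ N)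
    (x y : Plane) :
    𝓕⁻ (fun η => Complex.exp (2 * Real.pi * Complex.I * (inner ℝ (-x) η : ℝ)) *
      (rieszMult s N η : ℂ)) y = (rieszGauss s N (x - y) : ℂ) := by
  rw [← rieszGauss_neg, neg_sub, rieszGauss_eq hs hs1 hN, Real.fourierInv_eq']
  congr 1
  ext η
  rw [smul_eq_mul, ← mul_assoc, ← Complex.exp_add]
  congr 2
  rw [inner_neg_left, inner_sub_left, real_inner_comm]
  push_cast
  ring

/-- Square integrability is read off the frequency side: the function is the inverse transform of a
modulated multiplier lying in `L¹ ∩ L²`. -/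
theorem memLp_rieszGauss_sub {s : ℝ} (hs : 0 < s) (hs1 : s < 1) {N : ℕ} (hN : 1 ≤ N)
    (x : Plane) : MemLp (fun y => (rieszGauss s N (x - y) : ℂ)) 2 := by
  have h := coeFn_fourierInv_toLp (integrable_phase_mul_rieszMult hs1 hN (-x))
    (memLp_phase_mul_rieszMult hs1 hN (-x))
  refine (Lp.memLp _).ae_eq (h.trans (Filter.Eventually.of_forall fun y => ?_))
  exact fourierInv_phase_mul_rieszMult hs hs1 hN x y

/-- The `L²` Fourier transform of `g`, with the normalisation `exp (-2πi x·η)`. -/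
noncomputable def l2Fourier {g : Plane → ℂ} (hg : MemLp g 2) : Plane → ℂ :=
  (𝓕 (hg.toLp g) : Lp ℂ 2 (volume : Measure Plane))

theorem memLp_l2Fourier {g : Plane → ℂ} (hg : MemLp g 2) : MemLp (l2Fourier hg) 2 :=
  Lp.memLp _

theorem eLpNorm_l2Fourier {g : Plane → ℂ} (hg : MemLp g 2) :
    eLpNorm (l2Fourier hg) 2 volume = eLpNorm g 2 volume := by
  have h := Lp.norm_fourier_eq (hg.toLp g)
  rw [Lp.norm_def, Lp.norm_def, ENNReal.toReal_eq_toReal_iff' (Lp.eLpNorm_ne_top _)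
    (Lp.eLpNorm_ne_top _)] at h
  rw [l2Fourier, h]
  exact eLpNorm_congr_ae hg.coeFn_toLp

theorem integrable_rieszMult_mul_l2Fourier {s : ℝ} (hs1 : s < 1) {N : ℕ} (hN : 1 ≤ N)
    {g : Plane → ℂ} (hg : MemLp g 2) :
    Integrable fun η => (rieszMult s N η : ℂ) * l2Fourier hg η :=
  (memLp_rieszMult hs1 hN).ofReal.integrable_mul (memLp_l2Fourier hg)

/-- This is Parseval. Conjugation in the first slot of the inner product turns the phase of `-x`
into that of `x` and leaves the real multiplier unchanged. -/
theorem integral_rieszGauss_sub_mul {s : ℝ} (hs : 0 < s) (hs1 : s < 1) {N : ℕ} (hN : 1 ≤ N)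
    {g : Plane → ℂ} (hg : MemLp g 2) (x : Plane) :
    ∫ y, (rieszGauss s N (x - y) : ℂ) * g y =
      ∫ η, Complex.exp (2 * Real.pi * Complex.I * (inner ℝ x η : ℝ)) *
        ((rieszMult s N η : ℂ) * l2Fourier hg η) := by
  have hf := memLp_phase_mul_rieszMult hs1 hN (-x)
  have h := coeFn_fourierInv_toLp (integrable_phase_mul_rieszMult hs1 hN (-x)) hf
  have key := Lp.inner_fourier_eq (𝓕⁻ (hf.toLp _)) (hg.toLp g)
  rw [FourierTransform.fourier_fourierInv_eq, L2.inner_def, L2.inner_def] at key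
  refine Eq.trans ?_ (key.symm.trans ?_)
  · refine integral_congr_ae ?_
    filter_upwards [h, hg.coeFn_toLp] with y hy hgy
    rw [hy, hgy, fourierInv_phase_mul_rieszMult hs hs1 hN, RCLike.inner_apply,
      Complex.conj_ofReal, mul_comm]
  · refine integral_congr_ae ?_
    filter_upwards [hf.coeFn_toLp] with η hη
    rw [hη, RCLike.inner_apply, map_mul, Complex.conj_ofReal, ← Complex.exp_conj]
    simp only [map_mul, map_neg, Complex.conj_I, Complex.conj_ofReal, map_ofNat, inner_neg_left,
      Complex.ofReal_neg, l2Fourier]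
    rw [mul_comm, mul_assoc]
    congr 2
    ring

/-! ### Convergence of the convolutions and the flow as a frequency integral -/

/-- By Tonelli, integrating out the middle variable leaves `rieszGauss s N (x - y)` times `|g y|`, a
product of two `L²` functions. Both convergence claims and the associativity of the convolution
follow from this. -/
theorem integrable_gaussian_riesz_prod {s : ℝ} (hs : 0 < s) (hs1 : s < 1) {N : ℕ} (hN : 1 ≤ N)
    {g : Plane → ℂ} (hg : MemLp g 2) (x : Plane) :
    Integrable (fun p : Plane × Plane =>
      ((gaussianScale N (x - p.1) * rieszKernel s (p.1 - p.2) : ℝ) : ℂ) * g p.2)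
      (volume.prod volume) := by
  have hm : AEStronglyMeasurable (fun p : Plane × Plane =>
      ((gaussianScale N (x - p.1) * rieszKernel s (p.1 - p.2) : ℝ) : ℂ) * g p.2)
      (volume.prod volume) := by
    refine AEStronglyMeasurable.mul ?_ hg.1.comp_snd
    exact (by fun_prop : Measurable fun p : Plane × Plane =>
      ((gaussianScale N (x - p.1) * rieszKernel s (p.1 - p.2) : ℝ) : ℂ)).aestronglyMeasurable
  have hz : ∀ y, Integrable fun z => gaussianScale N (x - z) * rieszKernel s (z - y) := by
    intro y
    have h := (integrable_gaussianScale_mul_rieszKernel hs hs1 hN (x - y)).comp_sub_right y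
    refine h.congr (Filter.Eventually.of_forall fun z => ?_)
    simp
  have hval : ∀ y, ∫ z, gaussianScale N (x - z) * rieszKernel s (z - y) =
      rieszGauss s N (x - y) := by
    intro y
    rw [rieszGauss, ← integral_sub_right_eq_self
      (fun w => gaussianScale N (x - y - w) * rieszKernel s w) y]
    congr 1
    ext z
    simp
  rw [integrable_prod_iff' hm]
  constructor
  · refine Filter.Eventually.of_forall fun y => ?_
    have h : Integrable fun z =>
      ((gaussianScale N (x - z) * rieszKernel s (z - y) : ℝ) : ℂ) := (hz y).ofReal
    exact h.mul_const (g y)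
  · have h := ((memLp_rieszGauss_sub hs hs1 hN x).integrable_mul hg).norm
    refine h.congr (Filter.Eventually.of_forall fun y => ?_)
    have hG : 0 ≤ rieszGauss s N (x - y) := by
      rw [← hval]
      exact integral_nonneg fun z =>
        mul_nonneg (gaussianScale_pos hN _).le (rieszKernel_nonneg s _)
    simp only [Pi.mul_apply, norm_mul, Complex.norm_real]
    rw [Real.norm_of_nonneg hG, ← hval, ← integral_mul_const]
    congr 1
    ext z
    rw [Real.norm_of_nonneg (gaussianScale_pos hN _).le,
      Real.norm_of_nonneg (rieszKernel_nonneg s _)]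

theorem ae_convolutionExistsAt_rieszKernel {s : ℝ} (hs : 0 < s) (hs1 : s < 1)
    {g : Plane → ℂ} (hg : MemLp g 2) :
    ∀ᵐ x : Plane, ConvolutionExistsAt (rieszKernel s) g x
        (ContinuousLinearMap.lsmul ℝ ℝ) volume := by
  filter_upwards [(integrable_gaussian_riesz_prod hs hs1 le_rfl hg 0).prod_right_ae] with z hz
  rw [convolutionExistsAt_iff_integrable_swap]
  -- Almost every slice of the double integral converges, and the Gaussian weight is a nonzero
  -- constant on a slice, so it can be divided out.
  have hG := (gaussianScale_pos le_rfl (0 - z)).ne'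
  refine (hz.const_mul ((gaussianScale 1 (0 - z))⁻¹ : ℂ)).congr
    (Filter.Eventually.of_forall fun y => ?_)
  have hGc : (gaussianScale 1 (0 - z) : ℂ) ≠ 0 := by exact_mod_cast hG
  simp only [ContinuousLinearMap.lsmul_apply, Complex.real_smul]
  push_cast
  field_simp

theorem convolution_rieszKernel_apply (s : ℝ) (g : Plane → ℂ) (z : Plane) :
    (rieszKernel s ⋆ g) z = ∫ y, (rieszKernel s (z - y) : ℂ) * g y := by
  rw [convolution_eq_swap]
  simp

theorem convolutionExists_gaussianScale {s : ℝ} (hs : 0 < s) (hs1 : s < 1) {N : ℕ} (hN : 1 ≤ N)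
    {g : Plane → ℂ} (hg : MemLp g 2) :
    ConvolutionExists (gaussianScale N) (rieszKernel s ⋆ g)
      (ContinuousLinearMap.lsmul ℝ ℝ) volume := by
  intro x
  rw [convolutionExistsAt_iff_integrable_swap]
  refine (integrable_gaussian_riesz_prod hs hs1 hN hg x).integral_prod_left.congr
    (Filter.Eventually.of_forall fun z => ?_)
  simp only [ContinuousLinearMap.lsmul_apply, Complex.real_smul]
  rw [convolution_rieszKernel_apply, ← integral_const_mul]
  congr 1
  ext y
  push_cast
  ring

theorem convolution_gaussianScale_apply {s : ℝ} (hs : 0 < s) (hs1 : s < 1) {N : ℕ} (hN : 1 ≤ N)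
    {g : Plane → ℂ} (hg : MemLp g 2) (x : Plane) :
    (gaussianScale N ⋆ (rieszKernel s ⋆ g)) x =
      ∫ η, Complex.exp (2 * Real.pi * Complex.I * (inner ℝ x η : ℝ)) *
        ((rieszMult s N η : ℂ) * l2Fourier hg η) := by
  rw [← integral_rieszGauss_sub_mul hs hs1 hN hg x, convolution_eq_swap]
  have e1 : ∀ z, (ContinuousLinearMap.lsmul ℝ ℝ) (gaussianScale N (x - z))
      ((rieszKernel s ⋆ g) z) =
      ∫ y, ((gaussianScale N (x - z) * rieszKernel s (z - y) : ℝ) : ℂ) * g y := by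
    intro z
    simp only [ContinuousLinearMap.lsmul_apply, Complex.real_smul]
    rw [convolution_rieszKernel_apply, ← integral_const_mul]
    congr 1
    ext y
    push_cast
    ring
  simp only [e1]
  rw [integral_integral_swap (integrable_gaussian_riesz_prod hs hs1 hN hg x)]
  congr 1
  ext y
  rw [integral_mul_const, integral_complex_ofReal, rieszGauss,
    ← integral_sub_right_eq_self (fun w => gaussianScale N (x - y - w) * rieszKernel s w) y]
  congr 3
  ext z
  simp

theorem planeFourier_eq (φ : Plane → ℂ) (ξ : Plane) :
    planeFourier φ ξ = 𝓕 φ ((2 * Real.pi)⁻¹ • ξ) := by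
  have hpc : (Real.pi : ℂ) ≠ 0 := by exact_mod_cast Real.pi_pos.ne'
  rw [planeFourier, Real.fourier_eq']
  congr 1
  ext x
  rw [smul_eq_mul, inner_smul_right]
  congr 2
  push_cast
  field_simp

theorem integrable_planeFourier (φ : 𝓢(Plane, ℂ)) : Integrable (planeFourier φ) := by
  have h : Integrable fun ξ : Plane => (𝓕 φ) ((2 * Real.pi)⁻¹ • ξ) :=
    (𝓕 φ).integrable.comp_smul (inv_ne_zero (by positivity))
  refine h.congr (Filter.Eventually.of_forall fun ξ => ?_)
  simp only
  rw [planeFourier_eq, SchwartzMap.fourier_coe]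

theorem fourierInv_planeFourier (φ : 𝓢(Plane, ℂ)) (η : Plane) :
    𝓕⁻ (planeFourier φ) η = ((2 * Real.pi) ^ 2 : ℝ) • φ ((2 * Real.pi) • η) := by
  have h2 : (2 * Real.pi) ≠ 0 := by positivity
  have inv : 𝓕⁻ (𝓕 (φ : Plane → ℂ)) = φ := by
    rw [← SchwartzMap.fourier_coe, ← SchwartzMap.fourierInv_coe,
      FourierTransform.fourierInv_fourier_eq]
  have e := Measure.integral_comp_smul (volume : Measure Plane)
    (fun y : Plane => Complex.exp ((2 * Real.pi * inner ℝ y ((2 * Real.pi) • η) : ℝ) * Complex.I) •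
      𝓕 (φ : Plane → ℂ) y) (2 * Real.pi)⁻¹
  rw [← Real.fourierInv_eq', inv, finrank_euclideanSpace_fin, inv_pow, inv_inv,
    abs_of_nonneg (by positivity)] at e
  rw [← e, Real.fourierInv_eq']
  congr 1
  ext x
  rw [planeFourier_eq, inner_smul_left, inner_smul_right]
  congr 4
  simp
  field_simp

/-- A function given by an absolutely convergent inverse Fourier integral has the integrand, suitably
rescaled, as its distributional Fourier transform. -/
theorem isFourierTransform_of_eq_fourierInv {a F : Plane → ℂ} (ha : Integrable a)
    (hF : ∀ x, F x = 𝓕⁻ a x) :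
    IsFourierTransform F fun ξ => a ((2 * Real.pi)⁻¹ • ξ) := by
  obtain rfl : F = 𝓕⁻ a := funext hF
  have hcont : Continuous (𝓕⁻ a) := by
    rw [Real.fourierInv_eq_fourier_comp_neg]
    exact VectorFourier.fourierIntegral_continuous Real.continuous_fourierChar
      (by exact continuous_inner) ha.comp_neg
  intro φ
  refine ⟨?_, ?_, ?_⟩
  · refine (integrable_planeFourier φ).bdd_mul (c := ∫ η, ‖a η‖) hcont.aestronglyMeasurable
      (Filter.Eventually.of_forall fun x => ?_)
    exact VectorFourier.norm_fourierIntegral_le_integral_norm _ _ _ _ _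
  · exact (ha.comp_smul (inv_ne_zero (by positivity))).mul_bdd
      (c := ‖φ.toBoundedContinuousFunction‖) φ.continuous.aestronglyMeasurable
      (Filter.Eventually.of_forall φ.toBoundedContinuousFunction.norm_coe_le_norm)
  · have flip := VectorFourier.integral_fourierIntegral_smul_eq_flip (L := -innerₗ Plane)
      (μ := volume) (ν := volume) Real.continuous_fourierChar
      (by simpa using! continuous_inner.neg) ha (integrable_planeFourier φ)
    have hflip : ∫ x, 𝓕⁻ a x * planeFourier φ x = ∫ η, a η * 𝓕⁻ (planeFourier φ) η := by
      refine flip.trans ?_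
      congr 1
      ext x
      change a x • VectorFourier.fourierIntegral Real.fourierChar volume (-innerₗ Plane).flip
          (planeFourier φ) x =
        a x • VectorFourier.fourierIntegral Real.fourierChar volume (-innerₗ Plane)
          (planeFourier φ) x
      congr 2
      ext u v
      simpa using real_inner_comm _ _
    have e := Measure.integral_comp_smul (volume : Measure Plane)
      (fun ξ : Plane => a ((2 * Real.pi)⁻¹ • ξ) * φ ξ) (2 * Real.pi)
    rw [finrank_euclideanSpace_fin, abs_of_nonneg (by positivity)] at e
    rw [hflip]
    simp only [fourierInv_planeFourier, mul_smul_comm, integral_smul]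
    simp only [smul_smul, inv_mul_cancel₀ (show 2 * Real.pi ≠ 0 by positivity), one_smul] at e
    rw [e, smul_smul, mul_inv_cancel₀ (by positivity), one_smul]

/-- The characters of the saddle-shaped surface. -/
noncomputable def saddlePhase (z : Plane) (t : ℝ) (η : Plane) : ℂ :=
  Complex.exp (Complex.I * (inner ℝ z η : ℝ) - Complex.I * ((t * (η 0 ^ 2 - η 1 ^ 2) : ℝ) : ℂ))

theorem norm_saddlePhase (z : Plane) (t : ℝ) (η : Plane) : ‖saddlePhase z t η‖ = 1 := by
  rw [saddlePhase, ← mul_sub, ← Complex.ofReal_sub, mul_comm, Complex.norm_exp_ofReal_mul_I]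

theorem saddlePhase_mul_conj (z w : Plane) (t u : ℝ) (η : Plane) :
    saddlePhase z t η * (starRingEnd ℂ) (saddlePhase w u η) = saddlePhase (z - w) (t - u) η := by
  simp only [saddlePhase, ← Complex.exp_conj, ← Complex.exp_add]
  congr 1
  rw [inner_sub_left]
  simp only [map_sub, map_mul, Complex.conj_I, Complex.conj_ofReal]
  push_cast
  ring

theorem isFourierTransform_convolution {s : ℝ} (hs : 0 < s) (hs1 : s < 1) {N : ℕ} (hN : 1 ≤ N)
    {g : Plane → ℂ} (hg : MemLp g 2) :
    IsFourierTransform (gaussianScale N ⋆ (rieszKernel s ⋆ g)) fun ξ =>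
      (rieszMult s N ((2 * Real.pi)⁻¹ • ξ) : ℂ) * l2Fourier hg ((2 * Real.pi)⁻¹ • ξ) := by
  refine isFourierTransform_of_eq_fourierInv (integrable_rieszMult_mul_l2Fourier hs1 hN hg)
    fun x => ?_
  rw [convolution_gaussianScale_apply hs hs1 hN hg, Real.fourierInv_eq']
  congr 1
  ext η
  rw [smul_eq_mul, real_inner_comm]
  congr 2
  push_cast
  ring

/-- The substitution `ξ = 2πη` passes between the two Fourier normalizations. Its Jacobian cancels
the prefactor, and the time picks up `(2π)²`. -/
theorem schrodingerFlow_convolution {s : ℝ} (hs : 0 < s) (hs1 : s < 1) {N : ℕ} (hN : 1 ≤ N)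
    {g : Plane → ℂ} (hg : MemLp g 2) (t : ℝ) (x : Plane) :
    schrodingerFlow t (gaussianScale N ⋆ (rieszKernel s ⋆ g)) x =
      ∫ η, saddlePhase ((2 * Real.pi) • x) ((2 * Real.pi) ^ 2 * t) η *
        ((rieszMult s N η : ℂ) * l2Fourier hg η) := by
  have hT := isFourierTransform_convolution hs hs1 hN hg
  -- `fourierFunction` selects an unspecified representative; uniqueness up to null sets makes the
  -- choice irrelevant under the integral.
  have hae : fourierFunction (gaussianScale N ⋆ (rieszKernel s ⋆ g)) =ᵐ[volume] fun ξ =>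
      (rieszMult s N ((2 * Real.pi)⁻¹ • ξ) : ℂ) * l2Fourier hg ((2 * Real.pi)⁻¹ • ξ) := by
    have hex : ∃ h, IsFourierTransform (gaussianScale N ⋆ (rieszKernel s ⋆ g)) h := ⟨_, hT⟩
    rw [fourierFunction, dif_pos hex]
    exact hex.choose_spec.ae_eq hT
  have e := Measure.integral_comp_smul (volume : Measure Plane)
    (fun η : Plane => saddlePhase ((2 * Real.pi) • x) ((2 * Real.pi) ^ 2 * t) η *
        ((rieszMult s N η : ℂ) * l2Fourier hg η)) (2 * Real.pi)⁻¹
  rw [finrank_euclideanSpace_fin, inv_pow, inv_inv, abs_of_nonneg (by positivity)] at e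
  have e2 : ∫ ξ : Plane, Complex.exp (Complex.I * (inner ℝ x ξ : ℝ)) *
      Complex.exp (-(Complex.I * ((t * (ξ 0 ^ 2 - ξ 1 ^ 2) : ℝ) : ℂ))) *
        fourierFunction (gaussianScale N ⋆ (rieszKernel s ⋆ g)) ξ =
      ((2 * Real.pi) ^ 2 : ℝ) • ∫ η, saddlePhase ((2 * Real.pi) • x) ((2 * Real.pi) ^ 2 * t) η *
        ((rieszMult s N η : ℂ) * l2Fourier hg η) := by
    rw [← e]
    refine integral_congr_ae ?_
    filter_upwards [hae] with ξ hξ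
    rw [hξ, ← Complex.exp_add, saddlePhase, inner_smul_left, inner_smul_right]
    have hpc : (Real.pi : ℂ) ≠ 0 := by exact_mod_cast Real.pi_pos.ne'
    congr 2
    simp
    field_simp
    ring
  rw [schrodingerFlow, e2, Complex.real_smul, ← mul_assoc]
  have hpc : (Real.pi : ℂ) ≠ 0 := by exact_mod_cast Real.pi_pos.ne'
  push_cast
  rw [one_div, inv_mul_cancel₀ (pow_ne_zero 2 (mul_ne_zero two_ne_zero hpc)), one_mul]

/-! ### Riesz potentials of fractal measures -/

theorem measure_ball_le_fractalConst (α : ℝ) (μ : Measure Plane) (x : Plane) {r : ℝ}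
    (hr : 0 < r) : μ (Metric.ball x r) ≤ fractalConst α μ * ENNReal.ofReal (r ^ α) := by
  rw [← ENNReal.div_le_iff (by simpa using Real.rpow_pos_of_pos hr α) ENNReal.ofReal_ne_top]
  exact le_iSup_of_le x (le_iSup_of_le r (le_iSup_of_le hr le_rfl))

/-- Dyadic majorant of a negative power of the distance. -/
theorem enorm_rpow_neg_le_tsum {β : ℝ} (hβ : 0 < β) (z : Plane) :
    ‖z‖ₑ ^ (-β) ≤ 1 + ∑' j : ℕ, ENNReal.ofReal (2 ^ (β * (j + 1))) *
      (Metric.ball (0 : Plane) (2 * (1 / 2) ^ j)).indicator 1 z := by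
  rcases eq_or_ne z 0 with rfl | hz
  · have h : ∑' j : ℕ, ENNReal.ofReal (2 ^ (β * (j + 1))) *
        (Metric.ball (0 : Plane) (2 * (1 / 2) ^ j)).indicator (1 : Plane → ℝ≥0∞) 0 = ⊤ := by
      refine top_le_iff.1 ?_
      rw [← ENNReal.tsum_const_eq_top_of_ne_zero (α := ℕ) (one_ne_zero (α := ℝ≥0∞))]
      refine ENNReal.tsum_le_tsum fun j => ?_
      rw [indicator_of_mem (Metric.mem_ball_self (by positivity)), Pi.one_apply, mul_one,
        ENNReal.one_le_ofReal]
      exact Real.one_le_rpow one_le_two (by positivity)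
    rw [h]
    simp
  · have hz0 : 0 < ‖z‖ := norm_pos_iff.2 hz
    have e : ‖z‖ₑ ^ (-β) = ENNReal.ofReal (‖z‖ ^ (-β)) := by
      rw [← ENNReal.ofReal_rpow_of_pos hz0, ofReal_norm]
    rw [e]
    rcases le_or_gt 1 ‖z‖ with h1 | h1
    · refine le_trans ?_ le_self_add
      rw [ENNReal.ofReal_le_one]
      exact Real.rpow_le_one_of_one_le_of_nonpos h1 (by linarith)
    · obtain ⟨j, hj1, hj2⟩ := exists_nat_pow_near_of_lt_one hz0 h1.le
        (show (0 : ℝ) < 1 / 2 by norm_num) (by norm_num)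
      refine le_add_left (le_trans ?_ (ENNReal.le_tsum j))
      -- Since `|z|` may equal `2^(-j)`, the radius is doubled to place `z` in the open ball.
      have hmem : z ∈ Metric.ball (0 : Plane) (2 * (1 / 2) ^ j) := by
        rw [mem_ball_zero_iff]
        have : (0 : ℝ) < (1 / 2) ^ j := by positivity
        linarith
      rw [indicator_of_mem hmem, Pi.one_apply, mul_one]
      refine ENNReal.ofReal_le_ofReal ?_
      calc ‖z‖ ^ (-β) ≤ ((1 / 2 : ℝ) ^ (j + 1)) ^ (-β) :=
            Real.rpow_le_rpow_of_nonpos (by positivity) hj1.le (by linarith)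
        _ = 2 ^ (β * (j + 1)) := by
            rw [← Real.rpow_natCast, one_div, Real.inv_rpow two_pos.le,
              ← Real.rpow_neg two_pos.le, ← Real.rpow_mul two_pos.le]
            congr 1
            push_cast
            ring

/-- On dyadic balls around `y` the kernel gains `2^(βj)` while the mass loses `2^(-αj)`, so the
series is geometric with ratio `2^(β-α) < 1`. -/
theorem exists_lintegral_enorm_rpow_le {α β : ℝ} (hβ : 0 < β) (hα : β < α) {Ω : Set Plane}
    (hΩ : Bornology.IsBounded Ω) :
    ∃ C : ℝ≥0, ∀ μ : Measure Plane, IsFractalProbability α Ω μ →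
      ∀ y, ∫⁻ x, ‖x - y‖ₑ ^ (-β) ∂μ ≤ C * fractalConst α μ := by
  obtain ⟨R, hR0, hR⟩ := hΩ.subset_ball_lt 0 (0 : Plane)
  set q : ℝ≥0∞ := ENNReal.ofReal (2 ^ (β - α)) with hq
  have hq1 : q < 1 := by
    rw [hq, ENNReal.ofReal_lt_one]
    exact Real.rpow_lt_one_of_one_lt_of_neg one_lt_two (by linarith)
  have hfin : ENNReal.ofReal (R ^ α) + ENNReal.ofReal (2 ^ (α + β)) * (1 - q)⁻¹ ≠ ⊤ := by
    refine ENNReal.add_ne_top.2 ⟨ENNReal.ofReal_ne_top, ENNReal.mul_ne_top ENNReal.ofReal_ne_top ?_⟩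
    rw [Ne, ENNReal.inv_eq_top, tsub_eq_zero_iff_le, not_le]
    exact hq1
  refine ⟨(ENNReal.ofReal (R ^ α) + ENNReal.ofReal (2 ^ (α + β)) * (1 - q)⁻¹).toNNReal,
    fun μ hμ y => ?_⟩
  have := hμ.isProbability
  rw [ENNReal.coe_toNNReal hfin, add_mul]
  have hind : ∀ (j : ℕ) (x : Plane),
      (Metric.ball (0 : Plane) (2 * (1 / 2) ^ j)).indicator (1 : Plane → ℝ≥0∞) (x - y) =
      (Metric.ball y (2 * (1 / 2) ^ j)).indicator 1 x := by
    intro j x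
    simp only [Set.indicator, Metric.mem_ball, dist_eq_norm, sub_zero, Pi.one_apply]
  calc ∫⁻ x, ‖x - y‖ₑ ^ (-β) ∂μ
      ≤ ∫⁻ x, (1 + ∑' j : ℕ, ENNReal.ofReal (2 ^ (β * (j + 1))) *
          (Metric.ball y (2 * (1 / 2) ^ j)).indicator 1 x) ∂μ := by
        refine lintegral_mono fun x => ?_
        simp only [← hind]
        exact enorm_rpow_neg_le_tsum hβ (x - y)
    _ = μ univ + ∑' j : ℕ, ENNReal.ofReal (2 ^ (β * (j + 1))) *
          μ (Metric.ball y (2 * (1 / 2) ^ j)) := by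
        rw [lintegral_add_left measurable_const, lintegral_one, lintegral_tsum]
        · congr 2
          ext j
          rw [lintegral_const_mul _ (measurable_one.indicator Metric.isOpen_ball.measurableSet),
            lintegral_indicator_one Metric.isOpen_ball.measurableSet]
        · intro j
          exact ((measurable_one.indicator
            Metric.isOpen_ball.measurableSet).const_mul _).aemeasurable
    _ ≤ fractalConst α μ * ENNReal.ofReal (R ^ α) + ∑' j : ℕ,
          (fractalConst α μ * ENNReal.ofReal (2 ^ (α + β))) * q ^ j := by
        refine add_le_add ?_ (ENNReal.tsum_le_tsum fun j => ?_)
        -- Boundedness of `Ω` enters here: the total mass is also bounded by a multiple of `c_α(μ)`,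
        -- which keeps the whole estimate linear in that constant.
        · have h1 : μ univ ≤ μ (Metric.ball 0 R) := by
            rw [← union_compl_self Ω]
            refine (measure_union_le _ _).trans ?_
            rw [hμ.carried, add_zero]
            exact measure_mono hR
          exact h1.trans (measure_ball_le_fractalConst α μ 0 hR0)
        · refine (mul_le_mul_right (measure_ball_le_fractalConst α μ y (by positivity)) _).trans ?_
          rw [mul_left_comm, mul_assoc, hq, ← ENNReal.ofReal_pow (by positivity),
            ← ENNReal.ofReal_mul (by positivity), ← ENNReal.ofReal_mul (by positivity)]
          refine le_of_eq ?_
          congr 2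
          rw [← Real.rpow_natCast, ← Real.rpow_natCast, Real.mul_rpow two_pos.le (by positivity),
            one_div, Real.inv_rpow two_pos.le, ← Real.rpow_neg two_pos.le, ← Real.rpow_mul two_pos.le, ← Real.rpow_mul two_pos.le,
            ← Real.rpow_add two_pos, ← Real.rpow_add two_pos, ← Real.rpow_add two_pos]
          congr 1
          ring
    _ = _ := by
        rw [ENNReal.tsum_mul_left, ENNReal.tsum_geometric]
        ring

/-! ### The linearized operator and the `T T*` argument -/

theorem measurable_saddlePhase_comp {γ : Type*} [MeasurableSpace γ] {z : γ → Plane} {t : γ → ℝ}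
    {η : γ → Plane} (hz : Measurable z) (ht : Measurable t) (hη : Measurable η) :
    Measurable fun a => saddlePhase (z a) (t a) (η a) := by
  unfold saddlePhase
  have h0 : Measurable fun a => (η a) 0 := by fun_prop
  have h1 : Measurable fun a => (η a) 1 := by fun_prop
  have hi : Measurable fun a => inner ℝ (z a) (η a) := hz.inner hη
  fun_prop

theorem measurable_rieszMult_comp {γ : Type*} [MeasurableSpace γ] (s : ℝ) {N : γ → ℕ}
    {η : γ → Plane} (hN : Measurable N) (hη : Measurable η) :
    Measurable fun a => rieszMult s (N a) (η a) := by
  unfold rieszMult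
  have h0 : Measurable fun a => (N a : ℝ) := (measurable_of_countable _).comp hN
  fun_prop

theorem rieszMult_nonneg {s : ℝ} (hs : 0 < s) (hs1 : s < 1) (N : ℕ) (η : Plane) :
    0 ≤ rieszMult s N η := by
  have := rieszConst_nonneg hs hs1
  have := Real.pi_pos
  unfold rieszMult; positivity

/-- When the selected `N(x)` is bounded, the multiplier at the largest index is a common `L²`
majorant, which justifies every use of Fubini. -/
theorem rieszMult_mono {s : ℝ} (hs : 0 < s) (hs1 : s < 1) {N M : ℕ} (hN : 1 ≤ N) (hNM : N ≤ M)
    (η : Plane) : rieszMult s N η ≤ rieszMult s M η := by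
  have := rieszConst_nonneg hs hs1
  have := Real.pi_pos
  have hN0 : (0 : ℝ) < N := by exact_mod_cast hN
  unfold rieszMult
  gcongr

/-- The kernel of `T T*`, where `T` maps `ĝ` to the flow. -/
theorem exists_enorm_integral_rieszMult_saddlePhase_le {s : ℝ} (hs : 1 / 2 ≤ s) (hs1 : s < 1) :
    ∃ C : ℝ≥0, ∀ (N M : ℕ) (x y : Plane) (t : ℝ), 1 ≤ N → 1 ≤ M →
      ‖∫ η, ((rieszMult s N η * rieszMult s M η : ℝ) : ℂ) *
        saddlePhase ((2 * Real.pi) • (x - y)) t η‖ₑ ≤ C * ‖x - y‖ₑ ^ (-(2 - 2 * s)) := by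
  have hs0 : 0 < s := by linarith
  obtain ⟨C, hC, H⟩ := exists_norm_integral_riesz_saddle_le hs hs1
  have hc := rieszConst_nonneg hs0 hs1
  have hpi := Real.pi_pos
  set c : ℝ := (Real.pi * rieszConst s) ^ 2 with hcdef
  have hK : 0 ≤ c * (C * (2 * Real.pi) ^ (2 * s - 2)) := by positivity
  -- The added `1` makes the constant nonzero, so that on the diagonal the right-hand side is `⊤`
  -- and not `0 * ⊤ = 0`.
  refine ⟨Real.toNNReal (c * (C * (2 * Real.pi) ^ (2 * s - 2)) + 1), fun N M x y t hN hM => ?_⟩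
  rcases eq_or_ne x y with rfl | hxy
  · rw [sub_self, enorm_zero, ENNReal.zero_rpow_of_neg (by linarith), ENNReal.mul_top]
    · exact le_top
    · rw [Ne, ENNReal.coe_eq_zero, Real.toNNReal_eq_zero]
      linarith
  have hN0 : (0 : ℝ) < N := by exact_mod_cast hN
  have hM0 : (0 : ℝ) < M := by exact_mod_cast hM
  have hz : 0 < ‖x - y‖ := norm_pos_iff.2 (sub_ne_zero.2 hxy)
  have h := H (Real.pi ^ 2 / (N : ℝ) ^ 2 + Real.pi ^ 2 / (M : ℝ) ^ 2) t ((2 * Real.pi) • (x - y))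
    (by positivity) (smul_ne_zero (by positivity) (sub_ne_zero.2 hxy))
  have e : ∫ η, ((rieszMult s N η * rieszMult s M η : ℝ) : ℂ) *
        saddlePhase ((2 * Real.pi) • (x - y)) t η =
      (c : ℂ) * ∫ η : Plane, ((‖η‖ ^ (-(2 * s)) * Real.exp (-(Real.pi ^ 2 / (N : ℝ) ^ 2 +
        Real.pi ^ 2 / (M : ℝ) ^ 2) * ‖η‖ ^ 2) : ℝ) : ℂ) *
          saddlePhase ((2 * Real.pi) • (x - y)) t η := by
    rw [← integral_const_mul]
    congr 1
    ext η
    rw [← mul_assoc, ← Complex.ofReal_mul]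
    congr 2
    rw [rieszMult, rieszMult, neg_add, add_mul, Real.exp_add, hcdef,
      show -(2 * s) = -s * (2 : ℕ) by push_cast; ring, Real.rpow_mul (norm_nonneg _),
      Real.rpow_natCast]
    ring
  have hle : ‖∫ η, ((rieszMult s N η * rieszMult s M η : ℝ) : ℂ) *
        saddlePhase ((2 * Real.pi) • (x - y)) t η‖ ≤
      (c * (C * (2 * Real.pi) ^ (2 * s - 2)) + 1) * ‖x - y‖ ^ (-(2 - 2 * s)) := by
    rw [e, norm_mul, Complex.norm_real, Real.norm_of_nonneg (by positivity)]
    calc _ ≤ c * (C * ‖(2 * Real.pi) • (x - y)‖ ^ (2 * s - 2)) := by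
          refine mul_le_mul_of_nonneg_left h (by positivity)
      _ = c * (C * (2 * Real.pi) ^ (2 * s - 2)) * ‖x - y‖ ^ (-(2 - 2 * s)) := by
          rw [norm_smul, Real.norm_of_nonneg (by positivity),
            Real.mul_rpow (by positivity) hz.le, neg_sub]
          ring
      _ ≤ _ := by
          refine mul_le_mul_of_nonneg_right ?_ (by positivity)
          linarith
  have e2 : ‖x - y‖ₑ ^ (-(2 - 2 * s)) = ENNReal.ofReal (‖x - y‖ ^ (-(2 - 2 * s))) := by
    rw [← ENNReal.ofReal_rpow_of_pos hz, ofReal_norm]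
  rw [e2, ← ofReal_norm]
  change _ ≤ ENNReal.ofReal _ * _
  rw [← ENNReal.ofReal_mul (by positivity)]
  exact ENNReal.ofReal_le_ofReal hle

/-- `T T*` argument: an oscillating superposition of the functions `E x` is controlled in `L²` by
the kernel of their inner products. -/
theorem lintegral_enorm_sq_integral_le {μ : Measure Plane} [IsProbabilityMeasure μ]
    {E : Plane → Plane → ℂ} (hE : Measurable (Function.uncurry E)) {D : Plane → ℝ}
    (hD : MemLp D 2) (hED : ∀ x η, ‖E x η‖ ≤ D η) :
    ∫⁻ η, ‖∫ x, E x η ∂μ‖ₑ ^ 2 ≤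
      ∫⁻ x, ∫⁻ y, ‖∫ η, E x η * (starRingEnd ℂ) (E y η)‖ₑ ∂μ ∂μ := by
  have hHm : StronglyMeasurable fun η => ∫ x, E x η ∂μ :=
    (hE.comp measurable_swap).stronglyMeasurable.integral_prod_right'
  have hHD : ∀ η, ‖∫ x, E x η ∂μ‖ ≤ D η := fun η => by
    simpa using norm_integral_le_of_norm_le_const (μ := μ)
      (Filter.Eventually.of_forall fun x => hED x η)
  have hDsq : Integrable fun η => D η ^ 2 := hD.integrable_sq
  have hHsq : Integrable fun η => ‖∫ x, E x η ∂μ‖ ^ 2 := by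
    refine hDsq.mono' (hHm.norm.aestronglyMeasurable.pow 2) (Filter.Eventually.of_forall fun η => ?_)
    rw [Real.norm_of_nonneg (by positivity)]
    have := hHD η
    gcongr
  let K : Plane → Plane × Plane → ℂ := fun η p => E p.1 η * (starRingEnd ℂ) (E p.2 η)
  have hKm : Measurable (Function.uncurry K) := by
    have h1 : Measurable fun q : Plane × (Plane × Plane) => E q.2.1 q.1 :=
      hE.comp (by fun_prop : Measurable fun q : Plane × (Plane × Plane) => (q.2.1, q.1))
    have h2 : Measurable fun q : Plane × (Plane × Plane) => E q.2.2 q.1 :=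
      hE.comp (by fun_prop : Measurable fun q : Plane × (Plane × Plane) => (q.2.2, q.1))
    exact h1.mul (Complex.continuous_conj.measurable.comp h2)
  have hK : Integrable (Function.uncurry K) ((volume : Measure Plane).prod (μ.prod μ)) := by
    refine ((hDsq.comp_fst (μ.prod μ))).mono' hKm.aestronglyMeasurable
      (Filter.Eventually.of_forall fun q => ?_)
    simp only [Function.uncurry_def, K, norm_mul, RCLike.norm_conj]
    rw [sq]
    exact mul_le_mul (hED _ _) (hED _ _) (norm_nonneg _) ((norm_nonneg _).trans (hED q.2.1 _))
  -- The squared modulus is a double integral over `μ × μ`, which allows the frequency integral to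
  -- be taken first.
  have hsq : ∀ η, ((‖∫ x, E x η ∂μ‖ ^ 2 : ℝ) : ℂ) = ∫ p, K η p ∂(μ.prod μ) := by
    intro η
    rw [integral_prod_mul (fun x => E x η) (fun y => (starRingEnd ℂ) (E y η)), integral_conj,
      Complex.mul_conj, Complex.normSq_eq_norm_sq]
  calc ∫⁻ η, ‖∫ x, E x η ∂μ‖ₑ ^ 2 = ENNReal.ofReal (∫ η, ‖∫ x, E x η ∂μ‖ ^ 2) := by
        rw [ofReal_integral_eq_lintegral_ofReal hHsq
          (Filter.Eventually.of_forall fun η => by positivity)]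
        congr 1
        ext η
        rw [ENNReal.ofReal_pow (norm_nonneg _), ofReal_norm]
    _ = ‖∫ η, ∫ p, K η p ∂(μ.prod μ)‖ₑ := by
        simp only [← hsq]
        rw [integral_complex_ofReal, ← ofReal_norm, Complex.norm_real, Real.norm_of_nonneg]
        exact integral_nonneg fun η => by positivity
    _ = ‖∫ p, (∫ η, K η p) ∂(μ.prod μ)‖ₑ := by rw [integral_integral_swap hK]
    _ ≤ ∫⁻ p, ‖∫ η, K η p‖ₑ ∂(μ.prod μ) := enorm_integral_le_lintegral_enorm _
    _ = _ := by
        rw [lintegral_prod]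
        exact ((hKm.comp measurable_swap).stronglyMeasurable.integral_prod_right').enorm.aemeasurable

/-! ### From a measurable selection to the maximal function -/

/-- A measurable selection of an index at which finitely many functions attain their maximum. -/
theorem exists_measurable_argmax {X ι : Type*} [MeasurableSpace X] [MeasurableSpace ι]
    {S : Finset ι} (hS : S.Nonempty) {u : ι → X → ℝ≥0∞} (hu : ∀ i, Measurable (u i)) :
    ∃ σ : X → ι, Measurable σ ∧ Measurable (fun x => u (σ x) x) ∧ (∀ x, σ x ∈ S) ∧
      ∀ x, ∀ i ∈ S, u i x ≤ u (σ x) x := by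
  classical
  induction hS using Finset.Nonempty.cons_induction with
  | singleton a =>
    exact ⟨fun _ => a, measurable_const, hu a, fun x => by simp, fun x i hi => by
      rw [Finset.mem_singleton.1 hi]⟩
  | cons a S ha hS ih =>
    obtain ⟨σ, hσ, huσ, hmem, hmax⟩ := ih
    have hm : MeasurableSet {x | u (σ x) x ≤ u a x} := measurableSet_le huσ (hu a)
    refine ⟨fun x => if u (σ x) x ≤ u a x then a else σ x, Measurable.ite hm measurable_const hσ,
      ?_, fun x => ?_, fun x i hi => ?_⟩
    · have e : (fun x => u (if u (σ x) x ≤ u a x then a else σ x) x) =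
          fun x => if u (σ x) x ≤ u a x then u a x else u (σ x) x := by
        ext x; split_ifs <;> rfl
      rw [e]
      exact Measurable.ite hm (hu a) huσ
    · dsimp only
      split_ifs
      · simp
      · simp [hmem x]
    · rw [Finset.mem_cons] at hi
      dsimp only
      split_ifs with h
      · rcases hi with rfl | hi
        · exact le_rfl
        · exact (hmax x i hi).trans h
      · rcases hi with rfl | hi
        · exact (not_le.1 h).le
        · exact hmax x i hi

/-- The flow of the mollified Riesz potential, with varying time and mollification parameter. -/
noncomputable def linearizedFlow (s : ℝ) (G : Plane → ℂ) (t : ℝ) (N : ℕ) (x : Plane) : ℂ :=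
  ∫ η, saddlePhase ((2 * Real.pi) • x) ((2 * Real.pi) ^ 2 * t) η * ((rieszMult s N η : ℂ) * G η)

theorem measurable_linearizedFlow (s : ℝ) {G : Plane → ℂ} (hG : Measurable G) {t : Plane → ℝ}
    {N : Plane → ℕ} (ht : Measurable t) (hN : Measurable N) :
    Measurable fun x => linearizedFlow s G (t x) (N x) x := by
  unfold linearizedFlow
  have h1 : Measurable fun p : Plane × Plane =>
      saddlePhase ((2 * Real.pi) • p.1) ((2 * Real.pi) ^ 2 * t p.1) p.2 :=
    measurable_saddlePhase_comp (by fun_prop) (by fun_prop) measurable_snd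
  have h2 : Measurable fun p : Plane × Plane => rieszMult s (N p.1) p.2 :=
    measurable_rieszMult_comp s (hN.comp measurable_fst) measurable_snd
  have h3 : Measurable fun p : Plane × Plane =>
      saddlePhase ((2 * Real.pi) • p.1) ((2 * Real.pi) ^ 2 * t p.1) p.2 *
        ((rieszMult s (N p.1) p.2 : ℂ) * G p.2) := by fun_prop
  exact h3.stronglyMeasurable.integral_prod_right'.measurable

/-- Duality: the `L¹(μ)` norm is a pairing of `G` with a superposition of kernels, whose squared
`L²` norm is at most `C * A`. The constant is independent of the selections and of `M`; boundedness
of `N` serves only to make the integrals converge. -/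
theorem exists_lintegral_linearizedFlow_le {s : ℝ} (hs : 1 / 2 ≤ s) (hs1 : s < 1) :
    ∃ C : ℝ≥0, ∀ (μ : Measure Plane) (A : ℝ≥0∞), IsProbabilityMeasure μ →
      (∀ y, ∫⁻ x, ‖x - y‖ₑ ^ (-(2 - 2 * s)) ∂μ ≤ A) →
      ∀ (G : Plane → ℂ) (t : Plane → ℝ) (N : Plane → ℕ) (M : ℕ), Measurable G → MemLp G 2 →
        Measurable t → Measurable N → (∀ x, 1 ≤ N x) → (∀ x, N x ≤ M) →
          ∫⁻ x, ‖linearizedFlow s G (t x) (N x) x‖ₑ ∂μ ≤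
            eLpNorm G 2 volume * (C * A) ^ (1 / 2 : ℝ) := by
  have hs0 : 0 < s := by linarith
  obtain ⟨C, hC⟩ := exists_enorm_integral_rieszMult_saddlePhase_le hs hs1
  refine ⟨C, fun μ A hμ hA G t N M hGm hG ht hN hN1 hNM => ?_⟩
  let v : Plane → ℂ := fun x => linearizedFlow s G (t x) (N x) x
  have hv : Measurable v := measurable_linearizedFlow s hGm ht hN
  -- The conjugate phase of `v`. Division by zero gives `w = 0` where `v = 0`, so `w v = |v|` holds
  -- everywhere.
  let w : Plane → ℂ := fun x => (starRingEnd ℂ) (v x) / (‖v x‖ : ℂ)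
  have hw : Measurable w := by
    have := Complex.continuous_conj.measurable.comp hv
    exact this.div (by fun_prop)
  have hw1 : ∀ x, ‖w x‖ ≤ 1 := by
    intro x
    simp only [w, norm_div, RCLike.norm_conj, Complex.norm_real, norm_norm]
    exact div_self_le_one _
  have hwv : ∀ x, w x * v x = (‖v x‖ : ℂ) := by
    intro x
    rcases eq_or_ne (v x) 0 with h | h
    · simp [h]
    · have hn : (‖v x‖ : ℂ) ≠ 0 := by exact_mod_cast (norm_ne_zero_iff.2 h)
      simp only [w]
      rw [div_mul_eq_mul_div, mul_comm, Complex.mul_conj, Complex.normSq_eq_norm_sq, div_eq_iff hn]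
      push_cast
      ring
  let E : Plane → Plane → ℂ := fun x η => w x *
    (saddlePhase ((2 * Real.pi) • x) ((2 * Real.pi) ^ 2 * t x) η * (rieszMult s (N x) η : ℂ))
  have hE : Measurable (Function.uncurry E) := by
    have h1 : Measurable fun p : Plane × Plane =>
        saddlePhase ((2 * Real.pi) • p.1) ((2 * Real.pi) ^ 2 * t p.1) p.2 :=
      measurable_saddlePhase_comp (by fun_prop) (by fun_prop) measurable_snd
    have h2 : Measurable fun p : Plane × Plane => rieszMult s (N p.1) p.2 :=
      measurable_rieszMult_comp s (hN.comp measurable_fst) measurable_snd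
    simp only [E, Function.uncurry_def]
    fun_prop
  have hM : 1 ≤ M := (hN1 0).trans (hNM 0)
  have hED : ∀ x η, ‖E x η‖ ≤ rieszMult s M η := by
    intro x η
    simp only [E, norm_mul, norm_saddlePhase, one_mul, Complex.norm_real]
    rw [Real.norm_of_nonneg (rieszMult_nonneg hs0 hs1 _ _)]
    exact (mul_le_of_le_one_left (rieszMult_nonneg hs0 hs1 _ _) (hw1 x)).trans
      (rieszMult_mono hs0 hs1 (hN1 x) (hNM x) η)
  have hv_eq : ∀ x, (‖v x‖ : ℂ) = ∫ η, E x η * G η := by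
    intro x
    rw [← hwv x]
    simp only [v, linearizedFlow, E]
    rw [← integral_const_mul]
    congr 1
    ext η
    ring
  have hEG : Integrable (Function.uncurry fun x η => E x η * G η) (μ.prod volume) := by
    have h : Integrable fun η => rieszMult s M η * ‖G η‖ :=
      (memLp_rieszMult hs1 hM).integrable_mul hG.norm
    refine (h.comp_snd μ).mono' (hE.mul (hGm.comp measurable_snd)).aestronglyMeasurable
      (Filter.Eventually.of_forall fun p => ?_)
    simp only [Function.uncurry_def, norm_mul]
    exact mul_le_mul_of_nonneg_right (hED _ _) (norm_nonneg _)
  have hvi : Integrable (fun x => ‖v x‖) μ := by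
    have h := hEG.integral_prod_left.norm
    refine h.congr (Filter.Eventually.of_forall fun x => ?_)
    simp only [Function.uncurry_apply_pair]
    rw [← hv_eq, Complex.norm_real, norm_norm]
  have hHm : Measurable fun η => ∫ x, E x η ∂μ :=
    (hE.comp measurable_swap).stronglyMeasurable.integral_prod_right'.measurable
  have hL2 : ∫⁻ η, ‖∫ x, E x η ∂μ‖ₑ ^ 2 ≤ C * A := by
    refine (lintegral_enorm_sq_integral_le hE (memLp_rieszMult hs1 hM) hED).trans ?_
    have hker : ∀ x y, ‖∫ η, E x η * (starRingEnd ℂ) (E y η)‖ₑ ≤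
        C * ‖y - x‖ₑ ^ (-(2 - 2 * s)) := by
      intro x y
      have e : ∫ η, E x η * (starRingEnd ℂ) (E y η) = (w x * (starRingEnd ℂ) (w y)) *
          ∫ η, ((rieszMult s (N x) η * rieszMult s (N y) η : ℝ) : ℂ) *
            saddlePhase ((2 * Real.pi) • (x - y))
              ((2 * Real.pi) ^ 2 * t x - (2 * Real.pi) ^ 2 * t y) η := by
        rw [← integral_const_mul]
        congr 1
        ext η
        rw [smul_sub, ← saddlePhase_mul_conj]
        simp only [E, map_mul, Complex.conj_ofReal]
        push_cast
        ring
      rw [e, enorm_mul, enorm_mul, ← neg_sub x y, enorm_neg]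
      have h1 : ∀ x, ‖w x‖ₑ ≤ 1 := fun x => by
        rw [← ofReal_norm, ENNReal.ofReal_le_one]; exact hw1 x
      have h2 : ‖(starRingEnd ℂ) (w y)‖ₑ ≤ 1 := by
        rw [← ofReal_norm, RCLike.norm_conj, ofReal_norm]; exact h1 y
      calc _ ≤ 1 * 1 * (C * ‖x - y‖ₑ ^ (-(2 - 2 * s))) :=
            mul_le_mul' (mul_le_mul' (h1 x) h2) (hC _ _ x y _ (hN1 x) (hN1 y))
        _ = _ := by rw [one_mul, one_mul]
    calc _ ≤ ∫⁻ _x, C * A ∂μ := by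
          refine lintegral_mono fun x => ?_
          refine (lintegral_mono fun y => hker x y).trans ?_
          rw [lintegral_const_mul' _ _ ENNReal.coe_ne_top]
          exact mul_le_mul_right (hA x) _
      _ = C * A := by simp
  calc ∫⁻ x, ‖linearizedFlow s G (t x) (N x) x‖ₑ ∂μ = ENNReal.ofReal (∫ x, ‖v x‖ ∂μ) := by
        rw [ofReal_integral_eq_lintegral_ofReal hvi
          (Filter.Eventually.of_forall fun x => norm_nonneg _)]
        simp only [ofReal_norm, v]
    _ = ‖∫ x, (‖v x‖ : ℂ) ∂μ‖ₑ := by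
        rw [integral_complex_ofReal, ← ofReal_norm, Complex.norm_real, Real.norm_of_nonneg]
        exact integral_nonneg fun x => norm_nonneg _
    _ = ‖∫ η, (∫ x, E x η ∂μ) * G η‖ₑ := by
        simp only [hv_eq]
        rw [integral_integral_swap hEG]
        simp only [integral_mul_const]
    _ ≤ ∫⁻ η, ‖G η‖ₑ * ‖∫ x, E x η ∂μ‖ₑ := by
        refine (enorm_integral_le_lintegral_enorm _).trans_eq ?_
        simp only [enorm_mul, mul_comm]
    _ ≤ (∫⁻ η, ‖G η‖ₑ ^ (2 : ℝ)) ^ (1 / 2 : ℝ) *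
          (∫⁻ η, ‖∫ x, E x η ∂μ‖ₑ ^ (2 : ℝ)) ^ (1 / 2 : ℝ) :=
        ENNReal.lintegral_mul_le_Lp_mul_Lq volume Real.HolderConjugate.two_two
          hGm.enorm.aemeasurable hHm.enorm.aemeasurable
    _ ≤ eLpNorm G 2 volume * (C * A) ^ (1 / 2 : ℝ) := by
        refine mul_le_mul' (le_of_eq ?_) ?_
        · rw [eLpNorm_eq_lintegral_rpow_enorm_toReal two_ne_zero ENNReal.ofNat_ne_top]
          simp
        · refine ENNReal.rpow_le_rpow ?_ (by norm_num)
          simpa using hL2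

theorem measurable_l2Fourier {g : Plane → ℂ} (hg : MemLp g 2) : Measurable (l2Fourier hg) :=
  (Lp.stronglyMeasurable _).measurable

/-- The index set is countable, so it is exhausted by finite squares. On each one the supremum is
attained along a measurable selection, and the bound is uniform in the square. -/
theorem exists_lintegral_maximal_linearizedFlow_le {s : ℝ} (hs : 1 / 2 ≤ s) (hs1 : s < 1) :
    ∃ C : ℝ≥0, ∀ (μ : Measure Plane) (A : ℝ≥0∞), IsProbabilityMeasure μ →
      (∀ y, ∫⁻ x, ‖x - y‖ₑ ^ (-(2 - 2 * s)) ∂μ ≤ A) →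
      ∀ G : Plane → ℂ, Measurable G → MemLp G 2 →
          ∫⁻ x, ⨆ (k : ℕ) (_ : 1 ≤ k) (N : ℕ) (_ : 1 ≤ N),
            ‖linearizedFlow s G (1 / (k : ℝ)) N x‖ₑ ∂μ ≤
            eLpNorm G 2 volume * (C * A) ^ (1 / 2 : ℝ) := by
  obtain ⟨C, hC⟩ := exists_lintegral_linearizedFlow_le hs hs1
  refine ⟨C, fun μ A hμ hA G hGm hG => ?_⟩
  let u : ℕ × ℕ → Plane → ℝ≥0∞ := fun p x => ‖linearizedFlow s G (1 / (p.1 : ℝ)) p.2 x‖ₑ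
  have hu : ∀ p, Measurable (u p) := fun p =>
    (measurable_linearizedFlow s hGm measurable_const measurable_const).enorm
  -- The upper end `n + 1` keeps the square nonempty for `n = 0`, as the selection of a maximizer
  -- requires.
  let S : ℕ → Finset (ℕ × ℕ) := fun n => Finset.Icc 1 (n + 1) ×ˢ Finset.Icc 1 (n + 1)
  let F : ℕ → Plane → ℝ≥0∞ := fun n x => ⨆ p ∈ S n, u p x
  have hF : ∀ n, Measurable (F n) := fun n =>
    Measurable.biSup _ (S n).countable_toSet fun p _ => hu p
  have hmono : Monotone F := by
    intro m n hmn x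
    refine biSup_mono fun p hp => ?_
    simp only [S, Finset.mem_product, Finset.mem_Icc] at hp ⊢
    omega
  have hFle : ∀ n, ∫⁻ x, F n x ∂μ ≤ eLpNorm G 2 volume * (C * A) ^ (1 / 2 : ℝ) := by
    intro n
    have hS : (S n).Nonempty := ⟨(1, 1), by simp [S]⟩
    obtain ⟨σ, hσ, -, hmem, hmax⟩ := exists_measurable_argmax hS hu
    have hmem' : ∀ x, 1 ≤ (σ x).2 ∧ (σ x).2 ≤ n + 1 := fun x => by
      have := hmem x
      simp only [S, Finset.mem_product, Finset.mem_Icc] at this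
      exact this.2
    have h := hC μ A hμ hA G (fun x => 1 / ((σ x).1 : ℝ)) (fun x => (σ x).2) (n + 1) hGm hG
      ((measurable_of_countable fun p : ℕ × ℕ => 1 / (p.1 : ℝ)).comp hσ) (measurable_snd.comp hσ)
      (fun x => (hmem' x).1) (fun x => (hmem' x).2)
    exact (lintegral_mono fun x => iSup₂_le fun p hp => hmax x p hp).trans h
  calc _ ≤ ∫⁻ x, ⨆ n, F n x ∂μ := by
        refine lintegral_mono fun x => ?_
        refine iSup₂_le fun k hk => iSup₂_le fun N hN => ?_
        refine le_iSup_of_le (max k N) (le_iSup₂_of_le (k, N) ?_ le_rfl)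
        simp only [S, Finset.mem_product, Finset.mem_Icc]
        omega
    _ = ⨆ n, ∫⁻ x, F n x ∂μ := lintegral_iSup hF hmono
    _ ≤ _ := iSup_le hFle

theorem mainTheorem6 (Ω : Set Plane) (hΩo : IsOpen Ω) (hΩc : IsConnected Ω)
    (hΩb : Bornology.IsBounded Ω) (s α : ℝ) (hs : 1 / 2 ≤ s) (hs1 : s < 1) (hα : 2 - s < α) :
    (∀ g : Plane → ℂ, MemLp g 2 volume →
      (∀ᵐ x : Plane, ConvolutionExistsAt (rieszKernel s) g x
        (ContinuousLinearMap.lsmul ℝ ℝ) volume) ∧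
      ∀ N : ℕ, 1 ≤ N →
        ConvolutionExists (gaussianScale N) (rieszKernel s ⋆ g)
          (ContinuousLinearMap.lsmul ℝ ℝ) volume ∧
        ∃ h : Plane → ℂ, Integrable h ∧
          IsFourierTransform (gaussianScale N ⋆ (rieszKernel s ⋆ g)) h) ∧
    ∃ C : ℝ≥0, ∀ μ : Measure Plane, IsFractalProbability α Ω μ →
      ∀ g : Plane → ℂ, MemLp g 2 volume →
        ∫⁻ x, ⨆ (k : ℕ) (_ : 1 ≤ k) (N : ℕ) (_ : 1 ≤ N),
            ‖schrodingerFlow (1 / (k : ℝ)) (gaussianScale N ⋆ (rieszKernel s ⋆ g)) x‖ₑ ∂μ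
          ≤ C * fractalConst α μ ^ (1 / 2 : ℝ) * eLpNorm g 2 volume := by
  have hs0 : 0 < s := by linarith
  refine ⟨fun g hg => ⟨ae_convolutionExistsAt_rieszKernel hs0 hs1 hg, fun N hN =>
    ⟨convolutionExists_gaussianScale hs0 hs1 hN hg, _, ?_,
      isFourierTransform_convolution hs0 hs1 hN hg⟩⟩, ?_⟩
  · exact (integrable_rieszMult_mul_l2Fourier hs1 hN hg).comp_smul (inv_ne_zero (by positivity))
  · obtain ⟨C₁, h₁⟩ := exists_lintegral_maximal_linearizedFlow_le hs hs1
    -- The exponent `2 - 2s` is that of the `T T*` kernel; it is positive as `s < 1` and below `α`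
    -- as `2 - s < α`.
    obtain ⟨C₂, h₂⟩ := exists_lintegral_enorm_rpow_le (α := α) (β := 2 - 2 * s)
      (by linarith) (by linarith) hΩb
    refine ⟨(C₁ * C₂) ^ (1 / 2 : ℝ), fun μ hμ g hg => ?_⟩
    have h := h₁ μ _ hμ.isProbability (h₂ μ hμ) (l2Fourier hg) (measurable_l2Fourier hg)
      (memLp_l2Fourier hg)
    rw [eLpNorm_l2Fourier hg] at h
    refine le_trans (lintegral_mono fun x => ?_) (h.trans_eq ?_)
    · refine iSup₂_mono fun k _ => iSup₂_mono fun N hN => le_of_eq ?_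
      rw [schrodingerFlow_convolution hs0 hs1 hN hg, linearizedFlow]
    · rw [← mul_assoc, ENNReal.mul_rpow_of_nonneg _ _ (by norm_num), mul_comm,
        ENNReal.coe_rpow_of_nonneg _ (by norm_num), ENNReal.coe_mul]
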